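/- **Setting.** Let $n\ge 0$ and $a=\xi_0<\xi_1<\dots<\xi_n<\xi_{n+1}=b$ be reals, $\Omega_k=(\xi_{k-1},\xi_k)$ for $k=1,\dots,n+1$, and $\Omega=\bigcup_k\Omega_k$. Let $\rho_1,\dots,\rho_{n+1}$ be reals with $\rho_k^2>0$, and put $\rho(x)=\rho_k^2$ on $\Omega_k$. Let $q$ be a real-valued function that is continuous on each $\Omega_k$ and has finite one-sided limits at the end points of each $\Omega_k$. Let $\delta_j,\gamma_j$ ($1\le j\le4$) and $\delta^{\pm}_{ij},\gamma^{\pm}_{ij}$ ($1\le i\le n$, $j=0,1$) be real numbers. For $1\le j<k\le4$ let $\theta_{ijk}$ be the determinant of the $j$-th and $k$-th columns of $$\begin{bmatrix}\delta^+_{i1}&\delta^+_{i0}&\delta^-_{i1}&\delta^-_{i0}\\ \gamma^+_{i1}&\gamma^+_{i0}&\gamma^-_{i1}&\gamma^-_{i0}\end{bmatrix}.$$ Assume $\theta_{ijk}>0$ for all $i$ and all $j<k$, and $$\kappa_1=\det\begin{bmatrix}\delta_3&\delta_4\\ \delta_1&\delta_2\end{bmatrix}>0,\qquad \kappa_2=\det\begin{bmatrix}\gamma_3&\gamma_4\\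 \gamma_1&\gamma_2\end{bmatrix}>0.$$ For a function $u$ on $\Omega$, the values of $u$ and $u'$ at $a$, $b$ and $\xi_i\mp$ mean the corresponding one-sided limits. Put $\ell u=-\rho u''+qu$ and $$B_a[u]=\delta_1u(a)-\delta_2u'(a),\quad B_a'[u]=\delta_3u(a)-\delta_4u'(a),\quad B_b[u]=\gamma_1u(b)-\gamma_2u'(b),\quad B_b'[u]=\gamma_3u(b)-\gamma_4u'(b).$$ The *transmission conditions* are, for $i=1,\dots,n$, $$\delta^-_{i1}u'(\xi_i-)+\delta^-_{i0}u(\xi_i-)+\delta^+_{i1}u'(\xi_i+)+\delta^+_{i0}u(\xi_i+)=0,$$ $$\gamma^-_{i1}u'(\xi_i-)+\gamma^-_{i0}u(\xi_i-)+\gamma^+_{i1}u'(\xi_i+)+\gamma^+_{i0}u(\xi_i+)=0.$$ **The boundary value transmission problem.** A number $\lambda\in\mathbb C$ is an eigenvalue of the problem if there is a function $u:\Omega\to\mathbb C$, not identically zero, twice differentiable on $\Omega$, such that $u$ and $u'$ have finite one-sided limits at the end points of each $\Omega_k$, $\ell u=\lambda u$ on $\Omega$, $B_a[u]-\lambda B'_a[u]=0$,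 $B_b[u]+\lambda B_b'[u]=0$, and $u$ satisfies the transmission conditions. **The operator.** Let $\mathcal H=L_2(a,\xi_1)\oplus\dots\oplus L_2(\xi_n,b)\oplus\mathbb C^2$ be the Hilbert space with the inner product $$\langle F,G\rangle=\sum_{k=0}^{n}\frac1{\rho_{k+1}^2}\prod_{i=1}^{k}\theta_{i12}\prod_{i=k+1}^{n}\theta_{i34}\int_{\xi_k}^{\xi_{k+1}}f\,\overline g\,dx+\prod_{i=1}^n\theta_{i34}\,\frac{f_1\overline{g_1}}{\kappa_1}+\prod_{i=1}^n\theta_{i12}\,\frac{f_2\overline{g_2}}{\kappa_2}$$ for $F=(f,f_1,f_2)$, $G=(g,g_1,g_2)$. The domain of the operator $\mathfrak R$ consists of all $(f,f_1,f_2)\in\mathcal H$ such that (for a suitable representative $f$) $f$ is differentiable on each $\Omega_k$; $f$ and $f'$ are locally absolutely continuous on each $\Omega_k$ and have finite one-sided limits at its end points; $\ell f\in L_2(\Omega_k)$ for each $k$; $f$ satisfies the transmission conditions; $f_1=B_a'[f]$ and $f_2=-B_b'[f]$. On it, $\mathfrak R(f,B'_a[f],-B'_b[f])=(\ell f,B_a[f],B_b[f])$.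 **Theorem.** The operator $\mathfrak R$ is densely defined and self-adjoint in $\mathcal H$, and $\lambda\in\mathbb C$ is an eigenvalue of $\mathfrak R$ if and only if it is an eigenvalue of the boundary value transmission problem. -/

import Mathlib

open MeasureTheory Set Filter Topology

/-- The vector space `E` with its inner product multiplied by the constant `c > 0`. -/
def Scaled (_c : {r : ℝ // 0 < r}) (E : Type*) : Type _ := E

namespace Scaled

noncomputable section

variable {c : {r : ℝ // 0 < r}} {E : Type*} [NormedAddCommGroup E] [InnerProductSpace ℂ E]

instance instAddCommGroup : AddCommGroup (Scaled c E) := inferInstanceAs (AddCommGroup E)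

instance instModule : Module ℂ (Scaled c E) := inferInstanceAs (Module ℂ E)

/-- The identity map `Scaled c E → E`. -/
def val : Scaled c E ≃ₗ[ℂ] E := LinearEquiv.refl ℂ E

/-- Multiplication by `√c`, which becomes an isometry of `Scaled c E` onto `E`. -/
def toBase : Scaled c E ≃ₗ[ℂ] E :=
  val.trans (LinearEquiv.smulOfNeZero ℂ E ((Real.sqrt c.1 : ℝ) : ℂ)
    (by exact_mod_cast (Real.sqrt_pos.2 c.2).ne'))

theorem toBase_apply (x : Scaled c E) : toBase x = ((Real.sqrt c.1 : ℝ) : ℂ) • val x := rfl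

instance instNormedAddCommGroup : NormedAddCommGroup (Scaled c E) :=
  NormedAddCommGroup.induced (Scaled c E) E (toBase (c := c) (E := E)).toLinearMap
    (toBase (c := c) (E := E)).injective

theorem norm_eq (x : Scaled c E) : ‖x‖ = ‖toBase x‖ := rfl

instance instInnerProductSpace : InnerProductSpace ℂ (Scaled c E) where
  norm_smul_le r x := by rw [norm_eq, norm_eq, map_smul, norm_smul]
  inner x y := ((c.1 : ℝ) : ℂ) * inner ℂ (val x) (val y)
  norm_sq_eq_re_inner x := by
    rw [norm_eq, toBase_apply, norm_smul, mul_pow, inner_self_eq_norm_sq_to_K]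
    have h : (((c.1 : ℝ) : ℂ) * ((‖val x‖ : ℝ) : ℂ) ^ 2) = ((c.1 * ‖val x‖ ^ 2 : ℝ) : ℂ) := by
      push_cast; rfl
    have h' := congrArg Complex.re h
    rw [Complex.ofReal_re] at h'
    refine Eq.trans ?_ h'.symm
    rw [Complex.norm_real, Real.norm_eq_abs, sq_abs, Real.sq_sqrt c.2.le]
  conj_inner_symm x y := by
    rw [map_mul, inner_conj_symm, Complex.conj_ofReal]
  add_left x y z := by rw [map_add, inner_add_left, mul_add]
  smul_left x y r := by rw [map_smul, inner_smul_left]; ring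

theorem inner_eq (x y : Scaled c E) :
    inner ℂ x y = ((c.1 : ℝ) : ℂ) * inner ℂ (val x) (val y) := rfl

instance instCompleteSpace [CompleteSpace E] : CompleteSpace (Scaled c E) := by
  let e : Scaled c E ≃ₗᵢ[ℂ] E := ⟨toBase, fun x => (norm_eq x).symm⟩
  exact (completeSpace_congr (e := e.toEquiv) e.isometry.isUniformEmbedding).2 inferInstance

end

end Scaled

/-- `f` is locally absolutely continuous on the open interval `(s, t)`: it is absolutely continuous
on every compact subinterval. -/
def LocallyAC (f : ℝ → ℂ) (s t : ℝ) : Prop :=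
  ∀ x y, s < x → x ≤ y → y < t → AbsolutelyContinuousOnInterval f x y

/-- `f` has finite limits `f(s+0)` and `f(t-0)`. -/
def HasEndLimits {Y : Type*} [TopologicalSpace Y] (f : ℝ → Y) (s t : ℝ) : Prop :=
  (∃ l, Tendsto f (𝓝[>] s) (𝓝 l)) ∧ (∃ l, Tendsto f (𝓝[<] t) (𝓝 l))

theorem LocallyAC.ae_differentiableAt {f : ℝ → ℂ} {s t : ℝ} (hf : LocallyAC f s t) :
    ∀ᵐ x ∂(volume.restrict (Ioo s t)), DifferentiableAt ℝ f x := by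
  have hbv : LocallyBoundedVariationOn f (Ioo s t) := by
    intro x y hx hy
    rcases le_total x y with h | h
    · refine (hf x y hx.1 h hy.2).boundedVariationOn.mono ?_
      rw [uIcc_of_le h]; exact inter_subset_right
    · refine (hf y x hy.1 h hx.2).boundedVariationOn.mono ?_
      rw [uIcc_of_le h]
      rintro z ⟨-, h1, h2⟩
      exact ⟨h.trans h1, h2.trans h⟩
  rw [ae_restrict_iff' measurableSet_Ioo]
  filter_upwards [hbv.ae_differentiableWithinAt_of_mem] with x hx hxs
  exact (hx hxs).differentiableAt (isOpen_Ioo.mem_nhds hxs)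

theorem LocallyAC.congr {f g : ℝ → ℂ} {s t : ℝ} (hf : LocallyAC f s t)
    (h : EqOn g f (Ioo s t)) : LocallyAC g s t := by
  intro x y hx hxy hy
  have hs : uIcc x y ⊆ Ioo s t := by
    rw [uIcc_of_le hxy]; exact fun z hz => ⟨hx.trans_le hz.1, hz.2.trans_lt hy⟩
  have h1 := hf x y hx hxy hy
  rw [absolutelyContinuousOnInterval_iff] at h1 ⊢
  intro ε hε
  obtain ⟨d, hd, H⟩ := h1 ε hε
  refine ⟨d, hd, fun E hE hl => ?_⟩
  refine lt_of_eq_of_lt (Finset.sum_congr rfl fun i hi => ?_) (H E hE hl)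
  rw [h (hs (hE.1 i hi).1), h (hs (hE.1 i hi).2)]

theorem HasEndLimits.comb {f g h : ℝ → ℂ} {s t : ℝ} {c : ℂ} (hf : HasEndLimits f s t)
    (hst : s < t) (hg : HasEndLimits g s t) (H : EqOn h (fun x => f x + c * g x) (Ioo s t)) :
    HasEndLimits h s t ∧
      Function.rightLim h s = Function.rightLim f s + c * Function.rightLim g s ∧
      Function.leftLim h t = Function.leftLim f t + c * Function.leftLim g t := by
  obtain ⟨⟨l, hl⟩, m, hm⟩ := hf
  obtain ⟨⟨l', hl'⟩, m', hm'⟩ := hg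
  have h1 : Tendsto h (𝓝[>] s) (𝓝 (l + c * l')) := by
    refine (hl.add (hl'.const_mul c)).congr' ?_
    filter_upwards [Ioo_mem_nhdsGT hst] with x hx using (H hx).symm
  have h2 : Tendsto h (𝓝[<] t) (𝓝 (m + c * m')) := by
    refine (hm.add (hm'.const_mul c)).congr' ?_
    filter_upwards [Ioo_mem_nhdsLT hst] with x hx using (H hx).symm
  refine ⟨⟨⟨_, h1⟩, _, h2⟩, ?_, ?_⟩
  · rw [rightLim_eq_of_tendsto h1, rightLim_eq_of_tendsto hl, rightLim_eq_of_tendsto hl']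
  · rw [leftLim_eq_of_tendsto h2, leftLim_eq_of_tendsto hm, leftLim_eq_of_tendsto hm']

/-- The data of a boundary value transmission problem with `n` interior points, and the standing
assumptions on them.

The points are `a = ξ 0 < ξ 1 < ⋯ < ξ n < ξ (n + 1) = b`. The pieces `(ξ k, ξ (k + 1))` are indexed
by `k : Fin (n + 1)`; the interior point with index `i : Fin n` is `ξ (i + 1)`. The suffixes `p`
and `m` stand for the coefficients of the right (`+`) and left (`-`) limits. -/
structure TransmissionProblem (n : ℕ) where
  ξ : Fin (n + 2) → ℝ
  ξ_strictMono : StrictMono ξ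
  ρ : Fin (n + 1) → ℝ
  ρ_sq_pos : ∀ k, 0 < ρ k ^ 2
  q : ℝ → ℝ
  q_continuousOn : ∀ k : Fin (n + 1), ContinuousOn q (Ioo (ξ k.castSucc) (ξ k.succ))
  q_limits : ∀ k : Fin (n + 1), HasEndLimits q (ξ k.castSucc) (ξ k.succ)
  (δ₁ δ₂ δ₃ δ₄ : ℝ)
  (γ₁ γ₂ γ₃ γ₄ : ℝ)
  (δp0 δp1 δm0 δm1 : Fin n → ℝ)
  (γp0 γp1 γm0 γm1 : Fin n → ℝ)
  /-- All `2 × 2` minors of the transmission matrices are positive. -/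
  minor_pos : ∀ (i : Fin n) (j k : Fin 4), j < k →
    0 < ((!![δp1 i, δp0 i, δm1 i, δm0 i; γp1 i, γp0 i, γm1 i, γm0 i] :
      Matrix (Fin 2) (Fin 4) ℝ).submatrix id ![j, k]).det
  κ₁_pos : 0 < (!![δ₃, δ₄; δ₁, δ₂] : Matrix (Fin 2) (Fin 2) ℝ).det
  κ₂_pos : 0 < (!![γ₃, γ₄; γ₁, γ₂] : Matrix (Fin 2) (Fin 2) ℝ).det

namespace TransmissionProblem

noncomputable section

variable {n : ℕ} (P : TransmissionProblem n)

/-- The left end point. -/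
def a : ℝ := P.ξ 0

/-- The right end point. -/
def b : ℝ := P.ξ (Fin.last (n + 1))

/-- The `k`-th piece of `Ω`. -/
def piece (k : Fin (n + 1)) : Set ℝ := Ioo (P.ξ k.castSucc) (P.ξ k.succ)

/-- The `i`-th interior point. -/
def pt (i : Fin n) : ℝ := P.ξ i.castSucc.succ

/-- The coefficient matrix of the transmission conditions at the `i`-th interior point. -/
def transMatrix (i : Fin n) : Matrix (Fin 2) (Fin 4) ℝ :=
  !![P.δp1 i, P.δp0 i, P.δm1 i, P.δm0 i; P.γp1 i, P.γp0 i, P.γm1 i, P.γm0 i]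

/-- The minor of columns `j` and `k` (counted from `0`) of the transmission matrix. -/
def θ (i : Fin n) (j k : Fin 4) : ℝ := ((P.transMatrix i).submatrix id ![j, k]).det

def κ₁ : ℝ := (!![P.δ₃, P.δ₄; P.δ₁, P.δ₂] : Matrix (Fin 2) (Fin 2) ℝ).det

def κ₂ : ℝ := (!![P.γ₃, P.γ₄; P.γ₁, P.γ₂] : Matrix (Fin 2) (Fin 2) ℝ).det

theorem θ_pos (i : Fin n) {j k : Fin 4} (h : j < k) : 0 < P.θ i j k := P.minor_pos i j k h

/-! ### The differential expression and the boundary and transmission functionals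

A function on `Ω` is a function `u : ℝ → ℂ` of which only the restriction to the pieces matters;
its values at the points `ξ i` are one-sided limits. -/

/-- `-ρ u'' + q u` on the `k`-th piece, where `ρ = ρ_k²`. -/
def ell (k : Fin (n + 1)) (u : ℝ → ℂ) (x : ℝ) : ℂ :=
  -((P.ρ k : ℂ) ^ 2) * deriv (deriv u) x + (P.q x : ℂ) * u x

def Ba (u : ℝ → ℂ) : ℂ :=
  P.δ₁ * Function.rightLim u P.a - P.δ₂ * Function.rightLim (deriv u) P.a

def Ba' (u : ℝ → ℂ) : ℂ :=
  P.δ₃ * Function.rightLim u P.a - P.δ₄ * Function.rightLim (deriv u) P.a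

def Bb (u : ℝ → ℂ) : ℂ :=
  P.γ₁ * Function.leftLim u P.b - P.γ₂ * Function.leftLim (deriv u) P.b

def Bb' (u : ℝ → ℂ) : ℂ :=
  P.γ₃ * Function.leftLim u P.b - P.γ₄ * Function.leftLim (deriv u) P.b

/-- The first transmission functional at the `i`-th interior point. -/
def transδ (i : Fin n) (u : ℝ → ℂ) : ℂ :=
  P.δm1 i * Function.leftLim (deriv u) (P.pt i) + P.δm0 i * Function.leftLim u (P.pt i)
    + P.δp1 i * Function.rightLim (deriv u) (P.pt i) + P.δp0 i * Function.rightLim u (P.pt i)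

/-- The second transmission functional at the `i`-th interior point. -/
def transγ (i : Fin n) (u : ℝ → ℂ) : ℂ :=
  P.γm1 i * Function.leftLim (deriv u) (P.pt i) + P.γm0 i * Function.leftLim u (P.pt i)
    + P.γp1 i * Function.rightLim (deriv u) (P.pt i) + P.γp0 i * Function.rightLim u (P.pt i)

/-! ### The boundary value transmission problem -/

/-- `u` solves the problem with spectral parameter `lam`. -/
structure IsSolution (lam : ℂ) (u : ℝ → ℂ) : Prop where
  diff : ∀ k, DifferentiableOn ℝ u (P.piece k)
  diff' : ∀ k, DifferentiableOn ℝ (deriv u) (P.piece k)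
  lim : ∀ k : Fin (n + 1), HasEndLimits u (P.ξ k.castSucc) (P.ξ k.succ)
  lim' : ∀ k : Fin (n + 1), HasEndLimits (deriv u) (P.ξ k.castSucc) (P.ξ k.succ)
  eqn : ∀ k, ∀ x ∈ P.piece k, P.ell k u x = lam * u x
  left : P.Ba u - lam * P.Ba' u = 0
  right : P.Bb u + lam * P.Bb' u = 0
  trans₁ : ∀ i, P.transδ i u = 0
  trans₂ : ∀ i, P.transγ i u = 0

/-- `lam` is an eigenvalue of the boundary value transmission problem: there is a solution that does
not vanish identically on `Ω`. -/
def IsEigenvalue (lam : ℂ) : Prop :=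
  ∃ u, P.IsSolution lam u ∧ ∃ k, ∃ x ∈ P.piece k, u x ≠ 0

/-! ### The Hilbert space -/

/-- `∏_{i ≤ k} θ_{i12} ∏_{i > k} θ_{i34}`, the products being over the interior points, which are
numbered from `1` in this formula. -/
def thetaProd (k : Fin (n + 1)) : ℝ :=
  (∏ i : Fin n with i.val < k.val, P.θ i 0 1) * ∏ i : Fin n with k.val ≤ i.val, P.θ i 2 3

theorem thetaProd_pos (k : Fin (n + 1)) : 0 < P.thetaProd k :=
  mul_pos (Finset.prod_pos fun i _ => P.θ_pos i (by decide))
    (Finset.prod_pos fun i _ => P.θ_pos i (by decide))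

/-- The weight of the `k`-th piece in the inner product. -/
def weight (k : Fin (n + 1)) : {r : ℝ // 0 < r} :=
  ⟨1 / P.ρ k ^ 2 * P.thetaProd k,
    mul_pos (one_div_pos.2 (P.ρ_sq_pos k)) (P.thetaProd_pos k)⟩

/-- The weight of the component attached to `a`. -/
def weightA : {r : ℝ // 0 < r} :=
  ⟨(∏ i, P.θ i 2 3) / P.κ₁,
    div_pos (Finset.prod_pos fun i _ => P.θ_pos i (by decide)) P.κ₁_pos⟩

/-- The weight of the component attached to `b`. -/
def weightB : {r : ℝ // 0 < r} :=
  ⟨(∏ i, P.θ i 0 1) / P.κ₂,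
    div_pos (Finset.prod_pos fun i _ => P.θ_pos i (by decide)) P.κ₂_pos⟩

/-- Lebesgue measure on the `k`-th piece. -/
abbrev pieceMeasure (k : Fin (n + 1)) : Measure ℝ := volume.restrict (P.piece k)

/-- The direct sum of the spaces `L²(ξ k, ξ (k + 1))` with the weighted inner product. -/
abbrev H₁ : Type := PiLp 2 fun k => Scaled (P.weight k) (Lp ℂ 2 (P.pieceMeasure k))

/-- The Hilbert space `H₁ ⊕ ℂ²` with the weighted inner product. -/
abbrev H : Type := WithLp 2 (P.H₁ × WithLp 2 (Scaled P.weightA ℂ × Scaled P.weightB ℂ))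

variable {P} in
/-- The function component of `F` on the `k`-th piece. -/
def fn (F : P.H) (k : Fin (n + 1)) : Lp ℂ 2 (P.pieceMeasure k) := Scaled.val (F.fst k)

variable {P} in
/-- The component of `F` attached to `a`. -/
def cA (F : P.H) : ℂ := Scaled.val F.snd.fst

variable {P} in
/-- The component of `F` attached to `b`. -/
def cB (F : P.H) : ℂ := Scaled.val F.snd.snd

/-- The element of `H` with given components. -/
def mkH (f : ∀ k, Lp ℂ 2 (P.pieceMeasure k)) (z w : ℂ) : P.H :=
  WithLp.toLp 2 (WithLp.toLp 2 fun k => Scaled.val.symm (f k),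
    WithLp.toLp 2 (Scaled.val.symm z, Scaled.val.symm w))

variable {P} in
/-- The inner product of `H` (conjugate linear in the first argument). -/
theorem inner_eq (F G : P.H) :
    inner ℂ G F =
      (∑ k, ((1 / P.ρ k ^ 2 * P.thetaProd k : ℝ) : ℂ) *
        ∫ x in P.piece k, fn F k x * (starRingEnd ℂ) (fn G k x))
      + (((∏ i, P.θ i 2 3) / P.κ₁ : ℝ) : ℂ) * (cA F * (starRingEnd ℂ) (cA G))
      + (((∏ i, P.θ i 0 1) / P.κ₂ : ℝ) : ℂ) * (cB F * (starRingEnd ℂ) (cB G)) := by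
  rw [WithLp.prod_inner_apply, WithLp.prod_inner_apply, PiLp.inner_apply, ← add_assoc]
  rfl

variable {P} in
theorem H_ext {F G : P.H} (h : ∀ k, fn F k = fn G k) (hA : cA F = cA G) (hB : cB F = cB G) :
    F = G := by
  have h1 : F.fst = G.fst := PiLp.ext fun k => Scaled.val.injective (h k)
  have h2 : F.snd.fst = G.snd.fst := Scaled.val.injective hA
  have h3 : F.snd.snd = G.snd.snd := Scaled.val.injective hB
  have h4 : F.snd = G.snd := by
    apply (WithLp.equiv 2 _).injective
    exact Prod.ext h2 h3
  apply (WithLp.equiv 2 _).injective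
  exact Prod.ext h1 h4

/-! ### The operator -/

/-- `u` is a function on `Ω` representing the element `F` of the domain of the operator. -/
structure Represents (u : ℝ → ℂ) (F : P.H) : Prop where
  diff : ∀ k, DifferentiableOn ℝ u (P.piece k)
  ac : ∀ k : Fin (n + 1), LocallyAC u (P.ξ k.castSucc) (P.ξ k.succ)
  ac' : ∀ k : Fin (n + 1), LocallyAC (deriv u) (P.ξ k.castSucc) (P.ξ k.succ)
  lim : ∀ k : Fin (n + 1), HasEndLimits u (P.ξ k.castSucc) (P.ξ k.succ)
  lim' : ∀ k : Fin (n + 1), HasEndLimits (deriv u) (P.ξ k.castSucc) (P.ξ k.succ)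
  ell_memLp : ∀ k, MemLp (P.ell k u) 2 (P.pieceMeasure k)
  trans₁ : ∀ i, P.transδ i u = 0
  trans₂ : ∀ i, P.transγ i u = 0
  fn_eq : ∀ k, fn F k =ᵐ[P.pieceMeasure k] u
  cA_eq : cA F = P.Ba' u
  cB_eq : cB F = -P.Bb' u

variable {P}

/-- The image `(ℓ u, B_a[u], B_b[u])` of the element represented by `u`. -/
def Represents.image {u : ℝ → ℂ} {F : P.H} (h : P.Represents u F) : P.H :=
  P.mkH (fun k => (h.ell_memLp k).toLp (P.ell k u)) (P.Ba u) (P.Bb u)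

theorem isOpen_piece (k : Fin (n + 1)) : IsOpen (P.piece k) := isOpen_Ioo

theorem ξ_lt (k : Fin (n + 1)) : P.ξ k.castSucc < P.ξ k.succ :=
  P.ξ_strictMono (Fin.castSucc_lt_succ)

/-- On every piece, `w = u + c v`. -/
def IsComb (P : TransmissionProblem n) (c : ℂ) (u v w : ℝ → ℂ) : Prop :=
  ∀ k, EqOn w (fun x => u x + c * v x) (P.piece k)

section Linearity

variable {c : ℂ} {u v w : ℝ → ℂ} {F G : P.H}

theorem fn_comb (k : Fin (n + 1)) : fn (F + c • G) k = fn F k + c • fn G k := rfl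

theorem cA_comb : cA (F + c • G) = cA F + c * cA G := rfl

theorem cB_comb : cB (F + c • G) = cB F + c * cB G := rfl

theorem IsComb.deriv (h : P.IsComb c u v w) (hu : P.Represents u F) (hv : P.Represents v G) :
    P.IsComb c (deriv u) (deriv v) (deriv w) := by
  intro k x hx
  have hn := (isOpen_piece (P := P) k).mem_nhds hx
  have he : w =ᶠ[𝓝 x] fun x => u x + c * v x := by
    filter_upwards [hn] with y hy using h k hy
  have h1 := ((hu.diff k).differentiableAt hn).hasDerivAt
  have h2 := ((hv.diff k).differentiableAt hn).hasDerivAt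
  rw [he.deriv_eq]
  exact (h1.add (h2.const_mul c)).deriv

theorem IsComb.ell_ae (h : P.IsComb c u v w) (hu : P.Represents u F) (hv : P.Represents v G)
    (k : Fin (n + 1)) :
    P.ell k w =ᵐ[P.pieceMeasure k] fun x => P.ell k u x + c * P.ell k v x := by
  filter_upwards [(hu.ac' k).ae_differentiableAt, (hv.ac' k).ae_differentiableAt,
    ae_restrict_mem measurableSet_Ioo] with x h1 h2 hx
  have hn := (isOpen_piece (P := P) k).mem_nhds hx
  have he : _root_.deriv w =ᶠ[𝓝 x] fun x => _root_.deriv u x + c * _root_.deriv v x := by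
    filter_upwards [hn] with y hy using h.deriv hu hv k hy
  have h3 : _root_.deriv (_root_.deriv w) x =
      _root_.deriv (_root_.deriv u) x + c * _root_.deriv (_root_.deriv v) x := by
    rw [he.deriv_eq]
    exact (h1.hasDerivAt.add (h2.hasDerivAt.const_mul c)).deriv
  have h4 : w x = u x + c * v x := h k hx
  simp only [ell, h3, h4]
  ring

theorem IsComb.lims (h : P.IsComb c u v w) (hu : P.Represents u F) (hv : P.Represents v G)
    (k : Fin (n + 1)) :
    (HasEndLimits w (P.ξ k.castSucc) (P.ξ k.succ) ∧
      Function.rightLim w (P.ξ k.castSucc) =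
        Function.rightLim u (P.ξ k.castSucc) + c * Function.rightLim v (P.ξ k.castSucc) ∧
      Function.leftLim w (P.ξ k.succ) =
        Function.leftLim u (P.ξ k.succ) + c * Function.leftLim v (P.ξ k.succ)) ∧
    (HasEndLimits (_root_.deriv w) (P.ξ k.castSucc) (P.ξ k.succ) ∧
      Function.rightLim (_root_.deriv w) (P.ξ k.castSucc) =
        Function.rightLim (_root_.deriv u) (P.ξ k.castSucc)
          + c * Function.rightLim (_root_.deriv v) (P.ξ k.castSucc) ∧
      Function.leftLim (_root_.deriv w) (P.ξ k.succ) =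
        Function.leftLim (_root_.deriv u) (P.ξ k.succ)
          + c * Function.leftLim (_root_.deriv v) (P.ξ k.succ)) :=
  ⟨(hu.lim k).comb (ξ_lt k) (hv.lim k) (h k),
    (hu.lim' k).comb (ξ_lt k) (hv.lim' k) (h.deriv hu hv k)⟩

theorem IsComb.functionals (h : P.IsComb c u v w) (hu : P.Represents u F)
    (hv : P.Represents v G) :
    (P.Ba w = P.Ba u + c * P.Ba v ∧ P.Ba' w = P.Ba' u + c * P.Ba' v ∧
      P.Bb w = P.Bb u + c * P.Bb v ∧ P.Bb' w = P.Bb' u + c * P.Bb' v) ∧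
    (∀ i, P.transδ i w = P.transδ i u + c * P.transδ i v) ∧
    ∀ i, P.transγ i w = P.transγ i u + c * P.transγ i v := by
  have ha := (h.lims hu hv 0).1.2.1
  have ha' := (h.lims hu hv 0).2.2.1
  have hb := (h.lims hu hv (Fin.last n)).1.2.2
  have hb' := (h.lims hu hv (Fin.last n)).2.2.2
  rw [Fin.succ_last] at hb hb'
  rw [Fin.castSucc_zero] at ha ha'
  have hl i := (h.lims hu hv (Fin.castSucc i)).1.2.2
  have hl' i := (h.lims hu hv (Fin.castSucc i)).2.2.2
  have hr i := (h.lims hu hv (Fin.succ i)).1.2.1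
  have hr' i := (h.lims hu hv (Fin.succ i)).2.2.1
  simp only [← Fin.succ_castSucc] at hr hr'
  refine ⟨⟨?_, ?_, ?_, ?_⟩, fun i => ?_, fun i => ?_⟩
  · simp only [Ba, a, ha, ha']; ring
  · simp only [Ba', a, ha, ha']; ring
  · simp only [Bb, b, hb, hb']; ring
  · simp only [Bb', b, hb, hb']; ring
  · simp only [transδ, pt, hl, hl', hr, hr']; ring
  · simp only [transγ, pt, hl, hl', hr, hr']; ring

theorem Represents.comb (hu : P.Represents u F) (hv : P.Represents v G) (c : ℂ) :
    P.Represents (fun x => u x + c * v x) (F + c • G) := by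
  have h : P.IsComb c u v (fun x => u x + c * v x) := fun k x _ => rfl
  obtain ⟨⟨-, hA, -, hB⟩, ht1, ht2⟩ := h.functionals hu hv
  refine ⟨fun k => (hu.diff k).add ((hv.diff k).const_mul c), ?_, ?_, fun k => (h.lims hu hv k).1.1,
    fun k => (h.lims hu hv k).2.1, ?_, ?_, ?_, ?_, ?_, ?_⟩
  · intro k x y hx hxy hy
    exact (hu.ac k x y hx hxy hy).add ((hv.ac k x y hx hxy hy).const_smul c)
  · intro k
    refine LocallyAC.congr (f := fun x => _root_.deriv u x + c * _root_.deriv v x) ?_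
      (h.deriv hu hv k)
    intro x y hx hxy hy
    exact (hu.ac' k x y hx hxy hy).add ((hv.ac' k x y hx hxy hy).const_smul c)
  · intro k
    exact ((hu.ell_memLp k).add ((hv.ell_memLp k).const_mul c)).ae_eq (h.ell_ae hu hv k).symm
  · intro i; rw [ht1, hu.trans₁, hv.trans₁]; simp
  · intro i; rw [ht2, hu.trans₂, hv.trans₂]; simp
  · intro k
    rw [fn_comb]
    filter_upwards [Lp.coeFn_add (fn F k) (c • fn G k), Lp.coeFn_smul c (fn G k), hu.fn_eq k,
      hv.fn_eq k] with x h1 h2 h3 h4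
    rw [h1, Pi.add_apply, h2, Pi.smul_apply, h3, h4, smul_eq_mul]
  · rw [cA_comb, hA, hu.cA_eq, hv.cA_eq]
  · rw [cB_comb, hB, hu.cB_eq, hv.cB_eq]; ring

theorem Represents.eqOn (hu : P.Represents u F) (hv : P.Represents v F) (k : Fin (n + 1)) :
    EqOn u v (P.piece k) :=
  Measure.eqOn_open_of_ae_eq ((hu.fn_eq k).symm.trans (hv.fn_eq k)) (isOpen_piece k)
    (hu.diff k).continuousOn (hv.diff k).continuousOn

theorem Represents.image_comb (hu : P.Represents u F) (hv : P.Represents v G)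
    {K : P.H} (hw : P.Represents w K) (hK : K = F + c • G) :
    hw.image = hu.image + c • hv.image := by
  subst hK
  have h : P.IsComb c u v w := fun k => hw.eqOn (hu.comb hv c) k
  obtain ⟨⟨hA, -, hB, -⟩, -, -⟩ := h.functionals hu hv
  refine H_ext (fun k => ?_) hA hB
  rw [fn_comb]
  change (hw.ell_memLp k).toLp _ = (hu.ell_memLp k).toLp _ + c • (hv.ell_memLp k).toLp _
  rw [← MemLp.toLp_const_smul, ← MemLp.toLp_add]
  exact MemLp.toLp_congr _ _ (h.ell_ae hu hv k)

theorem represents_zero (P : TransmissionProblem n) : P.Represents (fun _ => 0) 0 := by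
  have hd : _root_.deriv (fun _ : ℝ => (0 : ℂ)) = fun _ => 0 := by funext x; simp
  have hl : ∀ x : ℝ, Function.leftLim (fun _ : ℝ => (0 : ℂ)) x = 0 := fun x =>
    leftLim_eq_of_tendsto tendsto_const_nhds
  have hr : ∀ x : ℝ, Function.rightLim (fun _ : ℝ => (0 : ℂ)) x = 0 := fun x =>
    rightLim_eq_of_tendsto tendsto_const_nhds
  have hac : ∀ s t, LocallyAC (fun _ : ℝ => (0 : ℂ)) s t := fun s t x y _ _ _ => by
    rw [absolutelyContinuousOnInterval_iff]
    exact fun ε hε => ⟨1, one_pos, fun E _ _ => by simpa using hε⟩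
  have hlim : ∀ s t, HasEndLimits (fun _ : ℝ => (0 : ℂ)) s t := fun s t =>
    ⟨⟨0, tendsto_const_nhds⟩, 0, tendsto_const_nhds⟩
  refine ⟨fun k => differentiableOn_const _, fun k => hac _ _, fun k => by rw [hd]; exact hac _ _,
    fun k => hlim _ _, fun k => by rw [hd]; exact hlim _ _, fun k => ?_, fun i => ?_, fun i => ?_,
    fun k => Lp.coeFn_zero _ _ _, ?_, ?_⟩
  · have : P.ell k (fun _ => 0) = fun _ => 0 := by funext x; simp [ell, hd]
    rw [this]
    exact MemLp.zero
  · simp [transδ, hd, hl, hr]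
  · simp [transγ, hd, hl, hr]
  · change (0 : ℂ) = _
    simp [Ba', hd, hr]
  · change (0 : ℂ) = _
    simp [Bb', hd, hl]

end Linearity

/-- The domain of the operator. -/
def dom (P : TransmissionProblem n) : Submodule ℂ P.H where
  carrier := {F | ∃ u, P.Represents u F}
  zero_mem' := ⟨_, represents_zero P⟩
  add_mem' := by
    rintro F G ⟨u, hu⟩ ⟨v, hv⟩
    exact ⟨_, by simpa only [one_smul] using hu.comb hv 1⟩
  smul_mem' := by
    rintro c F ⟨u, hu⟩
    exact ⟨_, by simpa only [zero_add] using (represents_zero P).comb hu c⟩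

theorem Represents.image_eq {F : P.H} {u v : ℝ → ℂ} (hu : P.Represents u F)
    (hv : P.Represents v F) : hu.image = hv.image := by
  have h := Represents.image_comb (c := 0) hv hv hu (by rw [zero_smul, add_zero])
  rwa [zero_smul, add_zero] at h

/-- The operator, `(u, B_a'[u], -B_b'[u]) ↦ (ℓ u, B_a[u], B_b[u])`. -/
def R (P : TransmissionProblem n) : P.H →ₗ.[ℂ] P.H where
  domain := P.dom
  toFun :=
    { toFun := fun F => (Classical.choose_spec F.2 : P.Represents _ F.1).image
      map_add' := by
        intro F G
        have hF : P.Represents _ F.1 := Classical.choose_spec F.2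
        have hG : P.Represents _ G.1 := Classical.choose_spec G.2
        have hS : P.Represents _ (F + G).1 := Classical.choose_spec (F + G).2
        have h := Represents.image_comb (c := 1) hF hG hS (by rw [one_smul]; rfl)
        rwa [one_smul] at h
      map_smul' := by
        intro c F
        have hF : P.Represents _ F.1 := Classical.choose_spec F.2
        have hS : P.Represents _ (c • F).1 := Classical.choose_spec (c • F).2
        have h := Represents.image_comb (c := c - 1) hF hF hS
          (by rw [sub_smul, one_smul, add_sub_cancel]; rfl)
        rw [sub_smul, one_smul, add_sub_cancel] at h
        exact h }

/-- The action of the operator does not depend on the representing function. -/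
theorem R_apply {u : ℝ → ℂ} (F : P.R.domain) (hu : P.Represents u (F : P.H)) :
    P.R F = hu.image :=
  Represents.image_eq (Classical.choose_spec F.2) hu

end

end TransmissionProblem

/-!
Integrating by parts on each piece gives the Lagrange identity: for `F` in the domain of `R` and a
pair `(G, L)` in the graph of the maximal operator, `⟪G, R F⟫ - ⟪L, F⟫` is a sum over the boundary
and interior points of products of boundary data of `F` with the defects of `(G, L)` in the
boundary and transmission conditions. The weights of the inner product are the ones for which
the terms at `a`, at `b` and at the interior points assemble in this way. Symmetry is the case of
vanishing defects.

Conversely let `⟪K, F⟫ = ⟪G, R F⟫` for all `F` in the domain. Test functions supported in a single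
piece and the lemma of du Bois-Reymond show that `(G, K)` lies in the graph of the maximal
operator. The determinants `κ₁`, `κ₂`, `θ i 0 1`, `θ i 2 3` do not vanish, so the boundary data of
`F` can be prescribed freely; matching them to the defects turns the Lagrange identity into a
vanishing sum of squares. Hence `(G, K)` lies in the graph of `R`. Density of the domain is the
case `G = 0`.

If `R F = lam • F`, the second derivative of the representing function agrees almost everywhere with
a continuous function, so the eigenvalue equation holds pointwise.
-/

open scoped ComplexConjugate

section AdjointPairs

variable {𝕜 E : Type*} [RCLike 𝕜] [NormedAddCommGroup E] [InnerProductSpace 𝕜 E]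

/-- `(G, K)` belongs to the graph of the adjoint relation of `T`. In contrast to
`LinearPMap.adjoint` this makes sense before `T` is known to be densely defined. -/
def IsAdjointPair (T : E →ₗ.[𝕜] E) (G K : E) : Prop :=
  ∀ F : T.domain, inner 𝕜 K (F : E) = inner 𝕜 G (T F)

theorem dense_domain_of_forall_isAdjointPair [CompleteSpace E] {T : E →ₗ.[𝕜] E}
    (hT : ∀ G K, IsAdjointPair T G K → (G, K) ∈ T.graph) : Dense (T.domain : Set E) := by
  rw [Submodule.dense_iff_topologicalClosure_eq_top, Submodule.topologicalClosure_eq_top_iff,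
    Submodule.eq_bot_iff]
  intro K hK
  have hpair : IsAdjointPair T 0 K := fun F => by
    rw [inner_zero_left, (Submodule.mem_orthogonal' _ _).1 hK F F.2]
  exact T.graph_fst_eq_zero_snd (hT 0 K hpair) rfl

theorem isSelfAdjoint_of_forall_isAdjointPair [CompleteSpace E] {T : E →ₗ.[𝕜] E}
    (hsymm : T.IsFormalAdjoint T) (hT : ∀ G K, IsAdjointPair T G K → (G, K) ∈ T.graph) :
    IsSelfAdjoint T := by
  have hdense := dense_domain_of_forall_isAdjointPair hT
  refine le_antisymm (LinearPMap.le_of_le_graph ?_) (hsymm.le_adjoint hdense)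
  rintro ⟨G, K⟩ hGK
  obtain ⟨G', rfl, rfl⟩ := LinearPMap.mem_graph_iff _ |>.1 hGK
  exact hT _ _ fun F => LinearPMap.adjoint_isFormalAdjoint hdense G' F

theorem mem_span_range_of_forall_inner_eq_zero {ι : Type*} [Finite ι] {e : ι → E} {f : E}
    (h : ∀ φ, (∀ i, inner 𝕜 (e i) φ = 0) → inner 𝕜 φ f = 0) :
    f ∈ Submodule.span 𝕜 (range e) := by
  have : FiniteDimensional 𝕜 (Submodule.span 𝕜 (range e)) :=
    FiniteDimensional.span_of_finite 𝕜 (finite_range e)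
  rw [← Submodule.orthogonal_orthogonal (Submodule.span 𝕜 (range e)), Submodule.mem_orthogonal]
  exact fun φ hφ => h φ fun i => (Submodule.mem_orthogonal _ _).1 hφ _
    (Submodule.subset_span (mem_range_self i))

end AdjointPairs

section AbsoluteContinuity

variable {X Y : Type*} [PseudoMetricSpace X] [PseudoMetricSpace Y] {s t : ℝ}

theorem absolutelyContinuousOnInterval_of_dist_le {f : ℝ → X} {g : ℝ → Y}
    (hg : AbsolutelyContinuousOnInterval g s t)
    (hfg : ∀ x ∈ uIcc s t, ∀ y ∈ uIcc s t, dist (f x) (f y) ≤ dist (g x) (g y)) :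
    AbsolutelyContinuousOnInterval f s t := by
  rw [absolutelyContinuousOnInterval_iff] at hg ⊢
  intro ε hε
  obtain ⟨η, hη, hlt⟩ := hg ε hε
  refine ⟨η, hη, fun I hI hlen => ?_⟩
  exact (Finset.sum_le_sum fun i hi => hfg _ (hI.1 i hi).1 _ (hI.1 i hi).2).trans_lt
    (hlt I hI hlen)

variable {E : Type*} [NormedAddCommGroup E] [NormedSpace ℝ E]

theorem absolutelyContinuousOnInterval_of_sub_eq_integral {f φ : ℝ → E}
    (hφ : IntervalIntegrable φ volume s t)
    (hf : ∀ x ∈ uIcc s t, ∀ y ∈ uIcc s t, f y - f x = ∫ z in x..y, φ z) :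
    AbsolutelyContinuousOnInterval f s t := by
  have hnorm : ∀ x ∈ uIcc s t, IntervalIntegrable (fun z => ‖φ z‖) volume s x := fun x hx =>
    hφ.norm.mono_set (uIcc_subset_uIcc_left hx)
  refine absolutelyContinuousOnInterval_of_dist_le
    (hφ.norm.absolutelyContinuousOnInterval_intervalIntegral left_mem_uIcc) fun x hx y hy => ?_
  rw [dist_comm, dist_comm (∫ v in s..x, ‖φ v‖), dist_eq_norm, dist_eq_norm, hf x hx y hy,
    intervalIntegral.integral_interval_sub_left (hnorm y hy) (hnorm x hx)]
  exact intervalIntegral.norm_integral_le_abs_integral_norm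

variable [CompleteSpace E]

/-- The fundamental theorem of calculus for absolutely continuous functions; Mathlib has it for
real-valued functions. -/
theorem sub_eq_integral_of_absolutelyContinuousOnInterval {f φ : ℝ → E}
    (hf : AbsolutelyContinuousOnInterval f s t) (hφ : IntervalIntegrable φ volume s t)
    (hderiv : ∀ᵐ x, x ∈ uIcc s t → HasDerivAt f (φ x) x) :
    f t - f s = ∫ x in s..t, φ x := by
  let g : ℝ → E := fun x => ∫ y in s..x, φ y
  have hφ' : ∀ x ∈ uIcc s t, IntervalIntegrable φ volume s x := fun x hx =>
    hφ.mono_set (uIcc_subset_uIcc_left hx)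
  have hg : AbsolutelyContinuousOnInterval g s t :=
    absolutelyContinuousOnInterval_of_sub_eq_integral hφ fun x hx y hy =>
      intervalIntegral.integral_interval_sub_left (hφ' y hy) (hφ' x hx)
  have hzero : ∀ᵐ x, x ∈ uIcc s t → HasDerivAt (f - g) 0 x := by
    filter_upwards [hderiv, hφ.ae_hasDerivAt_integral] with x hfx hgx hx
    simpa only [sub_self] using (hfx hx).sub (hgx hx s left_mem_uIcc)
  obtain ⟨C, hC⟩ := (hf.sub hg).const_of_ae_hasDerivAt_zero hzero
  have hends := (hC t right_mem_uIcc).trans (hC s left_mem_uIcc).symm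
  simp only [Pi.sub_apply, g, intervalIntegral.integral_same, sub_zero] at hends
  rw [← hends]
  abel

end AbsoluteContinuity

section OneSidedLimits

variable {Y : Type*} [TopologicalSpace Y] {f g : ℝ → Y} {s t : ℝ}

theorem tendsto_nhdsGT_of_eqOn_Ioo (hst : s < t) (hg : ContinuousAt g s)
    (h : EqOn f g (Ioo s t)) : Tendsto f (𝓝[>] s) (𝓝 (g s)) := by
  refine (hg.tendsto.mono_left nhdsWithin_le_nhds).congr' ?_
  filter_upwards [Ioo_mem_nhdsGT hst] with x hx using (h hx).symm

theorem tendsto_nhdsLT_of_eqOn_Ioo (hst : s < t) (hg : ContinuousAt g t)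
    (h : EqOn f g (Ioo s t)) : Tendsto f (𝓝[<] t) (𝓝 (g t)) := by
  refine (hg.tendsto.mono_left nhdsWithin_le_nhds).congr' ?_
  filter_upwards [Ioo_mem_nhdsLT hst] with x hx using (h hx).symm

theorem rightLim_congr [T2Space Y] (hst : s < t) (hf : ∃ l, Tendsto f (𝓝[>] s) (𝓝 l))
    (h : EqOn g f (Ioo s t)) : Function.rightLim g s = Function.rightLim f s := by
  obtain ⟨l, hl⟩ := hf
  rw [rightLim_eq_of_tendsto hl]
  refine rightLim_eq_of_tendsto (hl.congr' ?_)
  filter_upwards [Ioo_mem_nhdsGT hst] with x hx using (h hx).symm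

theorem leftLim_congr [T2Space Y] (hst : s < t) (hf : ∃ l, Tendsto f (𝓝[<] t) (𝓝 l))
    (h : EqOn g f (Ioo s t)) : Function.leftLim g t = Function.leftLim f t := by
  obtain ⟨l, hl⟩ := hf
  rw [leftLim_eq_of_tendsto hl]
  refine leftLim_eq_of_tendsto (hl.congr' ?_)
  filter_upwards [Ioo_mem_nhdsLT hst] with x hx using (h hx).symm

theorem memLp_top_of_hasEndLimits {E : Type*} [NormedAddCommGroup E] {f : ℝ → E}
    (hf : ContinuousOn f (Ioo s t)) (hlim : HasEndLimits f s t) :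
    MemLp f ⊤ (volume.restrict (Ioo s t)) := by
  obtain ⟨⟨l, hl⟩, m, hm⟩ := hlim
  obtain ⟨C, hC⟩ := isCompact_Icc.exists_bound_of_continuousOn
    (continuousOn_Icc_extendFrom_Ioo hf hl hm)
  refine memLp_top_of_bound (hf.aestronglyMeasurable measurableSet_Ioo) C ?_
  filter_upwards [ae_restrict_mem measurableSet_Ioo] with x hx
  simpa only [extendFrom_extends hf x hx] using hC x (Ioo_subset_Icc_self hx)

end OneSidedLimits

section Primitives

variable {E F : Type*} [NormedAddCommGroup E] [NormedSpace ℝ E] [NormedAddCommGroup F]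
  [NormedSpace ℝ F]

/-- `f` is a primitive of the integrable function `φ` on `(s, t)`. For some `φ` this holds exactly
when `f` belongs to the Sobolev space `W^{1,1}(s, t)`, and then `φ` is the weak derivative of
`f`. -/
structure IsPrimitiveOn (f φ : ℝ → E) (s t : ℝ) : Prop where
  integrableOn : IntegrableOn φ (Ioo s t)
  sub_eq : ∀ x ∈ Ioo s t, ∀ y ∈ Ioo s t, f y - f x = ∫ z in x..y, φ z

namespace IsPrimitiveOn

variable {f g φ ψ : ℝ → E} {s t : ℝ}

theorem intervalIntegrable (h : IsPrimitiveOn f φ s t) {x y : ℝ} (hx : x ∈ Ioo s t)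
    (hy : y ∈ Ioo s t) : IntervalIntegrable φ volume x y :=
  (h.integrableOn.mono_set (ordConnected_Ioo.uIcc_subset hx hy)).intervalIntegrable

theorem congr (h : IsPrimitiveOn f φ s t) (hfg : EqOn g f (Ioo s t))
    (hφψ : φ =ᵐ[volume.restrict (Ioo s t)] ψ) : IsPrimitiveOn g ψ s t where
  integrableOn := h.integrableOn.congr_fun_ae hφψ
  sub_eq x hx y hy := by
    rw [hfg hx, hfg hy, h.sub_eq x hx y hy]
    exact intervalIntegral.integral_congr_ae_restrict (ae_restrict_of_ae_restrict_of_subset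
      (uIoc_subset_uIcc.trans (ordConnected_Ioo.uIcc_subset hx hy)) hφψ)

theorem add (hf : IsPrimitiveOn f φ s t) (hg : IsPrimitiveOn g ψ s t) :
    IsPrimitiveOn (fun x => f x + g x) (fun x => φ x + ψ x) s t where
  integrableOn := hf.integrableOn.add hg.integrableOn
  sub_eq x hx y hy := by
    rw [intervalIntegral.integral_add (hf.intervalIntegrable hx hy) (hg.intervalIntegrable hx hy),
      ← hf.sub_eq x hx y hy, ← hg.sub_eq x hx y hy]
    abel

theorem sub (hf : IsPrimitiveOn f φ s t) (hg : IsPrimitiveOn g ψ s t) :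
    IsPrimitiveOn (fun x => f x - g x) (fun x => φ x - ψ x) s t where
  integrableOn := hf.integrableOn.sub hg.integrableOn
  sub_eq x hx y hy := by
    rw [intervalIntegral.integral_sub (hf.intervalIntegrable hx hy) (hg.intervalIntegrable hx hy),
      ← hf.sub_eq x hx y hy, ← hg.sub_eq x hx y hy]
    abel

theorem exists_extension (h : IsPrimitiveOn f φ s t) :
    ∃ g : ℝ → E, Continuous g ∧ EqOn f g (Ioo s t) ∧
      ∀ x y, g y - g x = ∫ z in x..y, (Ioo s t).indicator φ z := by
  have hint : Integrable ((Ioo s t).indicator φ) :=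
    h.integrableOn.integrable_indicator measurableSet_Ioo
  obtain ⟨m, hm⟩ : ∃ m, (Ioo s t).Nonempty → m ∈ Ioo s t :=
    ⟨(s + t) / 2, fun hne => by
      have := nonempty_Ioo.1 hne
      constructor <;> linarith⟩
  refine ⟨fun x => f m + ∫ z in m..x, (Ioo s t).indicator φ z,
    continuous_const.add (intervalIntegral.continuous_primitive
      (fun _ _ => hint.intervalIntegrable) m), fun x hx => ?_, fun x y => ?_⟩
  · have hcongr : ∫ z in m..x, (Ioo s t).indicator φ z = ∫ z in m..x, φ z :=
      intervalIntegral.integral_congr fun z hz =>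
        indicator_of_mem (ordConnected_Ioo.uIcc_subset (hm ⟨x, hx⟩) hx hz) _
    simp only [hcongr, ← h.sub_eq m (hm ⟨x, hx⟩) x hx, add_sub_cancel]
  · rw [add_sub_add_left_eq_sub]
    exact intervalIntegral.integral_interval_sub_left hint.intervalIntegrable
      hint.intervalIntegrable

theorem continuousOn (h : IsPrimitiveOn f φ s t) : ContinuousOn f (Ioo s t) := by
  obtain ⟨g, hg, hfg, -⟩ := h.exists_extension
  exact hg.continuousOn.congr hfg

theorem hasEndLimits (h : IsPrimitiveOn f φ s t) (hst : s < t) : HasEndLimits f s t := by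
  obtain ⟨g, hg, hfg, -⟩ := h.exists_extension
  exact ⟨⟨_, tendsto_nhdsGT_of_eqOn_Ioo hst hg.continuousAt hfg⟩,
    _, tendsto_nhdsLT_of_eqOn_Ioo hst hg.continuousAt hfg⟩

theorem integral_eq_leftLim_sub_rightLim (h : IsPrimitiveOn f φ s t) (hst : s < t) :
    ∫ x in Ioo s t, φ x = Function.leftLim f t - Function.rightLim f s := by
  obtain ⟨g, hg, hfg, hsub⟩ := h.exists_extension
  rw [leftLim_eq_of_tendsto (tendsto_nhdsLT_of_eqOn_Ioo hst hg.continuousAt hfg),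
    rightLim_eq_of_tendsto (tendsto_nhdsGT_of_eqOn_Ioo hst hg.continuousAt hfg), hsub s t,
    intervalIntegral.integral_of_le hst.le, integral_Ioc_eq_integral_Ioo,
    setIntegral_indicator measurableSet_Ioo, inter_self]

theorem memLp (h : IsPrimitiveOn f φ s t) (hst : s < t) (p : ENNReal) :
    MemLp f p (volume.restrict (Ioo s t)) :=
  (memLp_top_of_hasEndLimits h.continuousOn (h.hasEndLimits hst)).mono_exponent le_top

theorem absolutelyContinuousOnInterval (h : IsPrimitiveOn f φ s t) {x y : ℝ} (hx : x ∈ Ioo s t)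
    (hy : y ∈ Ioo s t) : AbsolutelyContinuousOnInterval f x y :=
  absolutelyContinuousOnInterval_of_sub_eq_integral (h.intervalIntegrable hx hy)
    fun z hz w hw => h.sub_eq z (ordConnected_Ioo.uIcc_subset hx hy hz) w
      (ordConnected_Ioo.uIcc_subset hx hy hw)

variable [CompleteSpace E] [CompleteSpace F]

theorem continuousLinearMap_comp (L : E →L[ℝ] F) (h : IsPrimitiveOn f φ s t) :
    IsPrimitiveOn (fun x => L (f x)) (fun x => L (φ x)) s t where
  integrableOn := L.integrable_comp h.integrableOn
  sub_eq x hx y hy := by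
    rw [L.intervalIntegral_comp_comm (h.intervalIntegrable hx hy), ← h.sub_eq x hx y hy, map_sub]

theorem hasDerivAt (h : IsPrimitiveOn f φ s t) (hφ : ContinuousOn φ (Ioo s t)) {x : ℝ}
    (hx : x ∈ Ioo s t) : HasDerivAt f (φ x) x := by
  have hnhds : Ioo s t ∈ 𝓝 x := isOpen_Ioo.mem_nhds hx
  have hprim : HasDerivAt (fun y => f x + ∫ z in x..y, φ z) (φ x) x :=
    (intervalIntegral.integral_hasDerivAt_right (IntervalIntegrable.refl)
      (hφ.stronglyMeasurableAtFilter isOpen_Ioo x hx) (hφ.continuousAt hnhds)).const_add _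
  refine hprim.congr_of_eventuallyEq ?_
  filter_upwards [hnhds] with y hy
  rw [← h.sub_eq x hx y hy, add_sub_cancel]

theorem ae_hasDerivAt (h : IsPrimitiveOn f φ s t) :
    ∀ᵐ x ∂volume.restrict (Ioo s t), HasDerivAt f (φ x) x := by
  obtain ⟨g, -, hfg, hsub⟩ := h.exists_extension
  have hint : Integrable ((Ioo s t).indicator φ) :=
    h.integrableOn.integrable_indicator measurableSet_Ioo
  filter_upwards [ae_restrict_mem measurableSet_Ioo,
    ae_restrict_of_ae (LocallyIntegrable.ae_hasDerivAt_integral hint.locallyIntegrable)]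
    with x hx hderiv
  have hg := (hderiv x).const_add (g x)
  rw [indicator_of_mem hx] at hg
  refine hg.congr_of_eventuallyEq ?_
  filter_upwards [isOpen_Ioo.mem_nhds hx] with y hy
  rw [hfg hy, ← hsub, add_sub_cancel]

theorem deriv_ae_eq (h : IsPrimitiveOn f φ s t) :
    deriv f =ᵐ[volume.restrict (Ioo s t)] φ :=
  h.ae_hasDerivAt.mono fun _ hx => hx.deriv

theorem of_absolutelyContinuousOnInterval (hφ : IntegrableOn φ (Ioo s t))
    (hf : ∀ x ∈ Ioo s t, ∀ y ∈ Ioo s t, AbsolutelyContinuousOnInterval f x y)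
    (hderiv : ∀ᵐ x ∂volume.restrict (Ioo s t), HasDerivAt f (φ x) x) :
    IsPrimitiveOn f φ s t where
  integrableOn := hφ
  sub_eq x hx y hy := by
    have hsub := ordConnected_Ioo.uIcc_subset hx hy
    refine sub_eq_integral_of_absolutelyContinuousOnInterval (hf x hx y hy)
      (hφ.mono_set hsub).intervalIntegrable ?_
    filter_upwards [(ae_restrict_iff' measurableSet_Ioo).1 hderiv] with z hz hz'
      using hz (hsub hz')

theorem of_hasDerivAt (hφ : IntegrableOn φ (Ioo s t))
    (hderiv : ∀ x ∈ Ioo s t, HasDerivAt f (φ x) x) : IsPrimitiveOn f φ s t where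
  integrableOn := hφ
  sub_eq x hx y hy := by
    have hsub := ordConnected_Ioo.uIcc_subset hx hy
    exact (intervalIntegral.integral_eq_sub_of_hasDerivAt (fun z hz => hderiv z (hsub hz))
      (hφ.mono_set hsub).intervalIntegrable).symm

theorem mul {𝕜 : Type*} [RCLike 𝕜] {f g φ ψ : ℝ → 𝕜} (hf : IsPrimitiveOn f φ s t)
    (hg : IsPrimitiveOn g ψ s t) (hst : s < t) :
    IsPrimitiveOn (fun x => f x * g x) (fun x => φ x * g x + f x * ψ x) s t := by
  refine of_absolutelyContinuousOnInterval (Integrable.add ?_ ?_) (fun x hx y hy => ?_) ?_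
  · exact hf.integrableOn.mul_of_top_left (hg.memLp hst ⊤)
  · exact hg.integrableOn.mul_of_top_right (hf.memLp hst ⊤)
  · exact (hf.absolutelyContinuousOnInterval hx hy).smul (hg.absolutelyContinuousOnInterval hx hy)
  · filter_upwards [hf.ae_hasDerivAt, hg.ae_hasDerivAt] with x hfx hgx using hfx.mul hgx

end IsPrimitiveOn

theorem exists_isPrimitiveOn_rightLim_eq {φ : ℝ → E} {s t : ℝ} (hst : s < t)
    (hφ : IntegrableOn φ (Ioo s t)) (α : E) :
    ∃ f, IsPrimitiveOn f φ s t ∧ Function.rightLim f s = α := by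
  have hint : Integrable ((Ioo s t).indicator φ) := hφ.integrable_indicator measurableSet_Ioo
  let f : ℝ → E := fun x => α + ∫ z in s..x, (Ioo s t).indicator φ z
  have hf : Continuous f := continuous_const.add
    (intervalIntegral.continuous_primitive (fun _ _ => hint.intervalIntegrable) s)
  refine ⟨f, ⟨hφ, fun x hx y hy => ?_⟩, ?_⟩
  · simp only [f, add_sub_add_left_eq_sub]
    rw [intervalIntegral.integral_interval_sub_left hint.intervalIntegrable
      hint.intervalIntegrable]
    exact intervalIntegral.integral_congr fun z hz =>
      indicator_of_mem (ordConnected_Ioo.uIcc_subset hx hy hz) _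
  · rw [rightLim_eq_of_tendsto (tendsto_nhdsGT_of_eqOn_Ioo hst hf.continuousAt
      (eqOn_refl f (Ioo s t)))]
    simp only [f, intervalIntegral.integral_same, add_zero]

theorem isPrimitiveOn_deriv_of_locallyAC {f : ℝ → ℂ} {s t : ℝ} (hf : LocallyAC f s t)
    (hint : IntegrableOn (deriv f) (Ioo s t)) : IsPrimitiveOn f (deriv f) s t := by
  refine .of_absolutelyContinuousOnInterval hint (fun x hx y hy => ?_)
    (hf.ae_differentiableAt.mono fun _ hx => hx.hasDerivAt)
  rcases le_total x y with hxy | hyx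
  · exact hf x y hx.1 hxy hy.2
  · exact (hf y x hy.1 hyx hx.2).symm

theorem IsPrimitiveOn.locallyAC {f φ : ℝ → ℂ} {s t : ℝ} (h : IsPrimitiveOn f φ s t) :
    LocallyAC f s t := fun _ _ hx hxy hy =>
  h.absolutelyContinuousOnInterval ⟨hx, hxy.trans_lt hy⟩ ⟨hx.trans_le hxy, hy⟩

end Primitives

section SobolevTwo

variable {E : Type*} [NormedAddCommGroup E] [NormedSpace ℝ E] {u v w φ : ℝ → E} {s t : ℝ}

/-- `u` belongs to the Sobolev space `H²(s, t)`. The derivatives are pointwise ones: `u` is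
continuously differentiable on `(s, t)`, and `deriv (deriv u)` exists almost everywhere. -/
structure MemH2 (u : ℝ → E) (s t : ℝ) : Prop where
  isPrimitiveOn : IsPrimitiveOn u (deriv u) s t
  isPrimitiveOn_deriv : IsPrimitiveOn (deriv u) (deriv (deriv u)) s t
  memLp_deriv_deriv : MemLp (deriv (deriv u)) 2 (volume.restrict (Ioo s t))

/-- The pair `(u(x+), u'(x+))`. -/
noncomputable def rightTrace (u : ℝ → E) (x : ℝ) : E × E :=
  (Function.rightLim u x, Function.rightLim (deriv u) x)

/-- The pair `(u(x-), u'(x-))`. -/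
noncomputable def leftTrace (u : ℝ → E) (x : ℝ) : E × E :=
  (Function.leftLim u x, Function.leftLim (deriv u) x)

theorem rightTrace_of_contDiff (hu : ContDiff ℝ 2 u) (x : ℝ) :
    rightTrace u x = (u x, deriv u x) := by
  rw [rightTrace, rightLim_eq_of_tendsto hu.continuous.continuousWithinAt,
    rightLim_eq_of_tendsto (hu.continuous_deriv one_le_two).continuousWithinAt]

theorem leftTrace_of_contDiff (hu : ContDiff ℝ 2 u) (x : ℝ) :
    leftTrace u x = (u x, deriv u x) := by
  rw [leftTrace, leftLim_eq_of_tendsto hu.continuous.continuousWithinAt,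
    leftLim_eq_of_tendsto (hu.continuous_deriv one_le_two).continuousWithinAt]

namespace MemH2

theorem tendsto_rightTrace (h : MemH2 u s t) (hst : s < t) :
    Tendsto (fun x => (u x, deriv u x)) (𝓝[>] s) (𝓝 (rightTrace u s)) :=
  (tendsto_rightLim_of_tendsto (h.isPrimitiveOn.hasEndLimits hst).1).prodMk_nhds
    (tendsto_rightLim_of_tendsto (h.isPrimitiveOn_deriv.hasEndLimits hst).1)

theorem tendsto_leftTrace (h : MemH2 u s t) (hst : s < t) :
    Tendsto (fun x => (u x, deriv u x)) (𝓝[<] t) (𝓝 (leftTrace u t)) :=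
  (tendsto_leftLim_of_tendsto (h.isPrimitiveOn.hasEndLimits hst).2).prodMk_nhds
    (tendsto_leftLim_of_tendsto (h.isPrimitiveOn_deriv.hasEndLimits hst).2)

theorem memLp_two (h : MemH2 u s t) (hst : s < t) : MemLp u 2 (volume.restrict (Ioo s t)) :=
  h.isPrimitiveOn.memLp hst 2

theorem rightTrace_congr (hu : MemH2 u s t) (hst : s < t) (huv : EqOn v u (Ioo s t)) :
    rightTrace v s = rightTrace u s := by
  rw [rightTrace, rightTrace, rightLim_congr hst (hu.isPrimitiveOn.hasEndLimits hst).1 huv,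
    rightLim_congr hst (hu.isPrimitiveOn_deriv.hasEndLimits hst).1 (huv.deriv isOpen_Ioo)]

theorem leftTrace_congr (hu : MemH2 u s t) (hst : s < t) (huv : EqOn v u (Ioo s t)) :
    leftTrace v t = leftTrace u t := by
  rw [leftTrace, leftTrace, leftLim_congr hst (hu.isPrimitiveOn.hasEndLimits hst).2 huv,
    leftLim_congr hst (hu.isPrimitiveOn_deriv.hasEndLimits hst).2 (huv.deriv isOpen_Ioo)]

variable [CompleteSpace E]

theorem hasDerivAt (h : MemH2 u s t) {x : ℝ} (hx : x ∈ Ioo s t) : HasDerivAt u (deriv u x) x :=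
  h.isPrimitiveOn.hasDerivAt h.isPrimitiveOn_deriv.continuousOn hx

theorem differentiableOn (h : MemH2 u s t) : DifferentiableOn ℝ u (Ioo s t) := fun _ hx =>
  (h.hasDerivAt hx).differentiableAt.differentiableWithinAt

end MemH2

variable [CompleteSpace E]

theorem IsPrimitiveOn.eqOn_deriv (hu : IsPrimitiveOn u w s t) (hw : ContinuousOn w (Ioo s t)) :
    EqOn (deriv u) w (Ioo s t) :=
  fun _ hx => (hu.hasDerivAt hw hx).deriv

theorem IsPrimitiveOn.deriv_deriv_ae_eq (hu : IsPrimitiveOn u w s t)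
    (hw : IsPrimitiveOn w φ s t) : deriv (deriv u) =ᵐ[volume.restrict (Ioo s t)] φ := by
  filter_upwards [hw.deriv_ae_eq, ae_restrict_mem measurableSet_Ioo] with x hφ hx
  rw [← hφ]
  exact ((hu.eqOn_deriv hw.continuousOn).eventuallyEq_of_mem (isOpen_Ioo.mem_nhds hx)).deriv_eq

theorem IsPrimitiveOn.memH2 (hu : IsPrimitiveOn u w s t) (hw : IsPrimitiveOn w φ s t)
    (hφ : MemLp φ 2 (volume.restrict (Ioo s t))) : MemH2 u s t where
  isPrimitiveOn := hu.congr (eqOn_refl _ _)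
    ((hu.eqOn_deriv hw.continuousOn).symm.aeEq_restrict measurableSet_Ioo)
  isPrimitiveOn_deriv :=
    hw.congr (hu.eqOn_deriv hw.continuousOn) (hu.deriv_deriv_ae_eq hw).symm
  memLp_deriv_deriv := hφ.ae_eq (hu.deriv_deriv_ae_eq hw).symm

theorem MemH2.congr (hu : MemH2 u s t) (huv : EqOn v u (Ioo s t)) : MemH2 v s t :=
  (hu.isPrimitiveOn.congr huv .rfl).memH2 hu.isPrimitiveOn_deriv hu.memLp_deriv_deriv

theorem memH2_of_contDiff (hu : ContDiff ℝ 2 u) (s t : ℝ) : MemH2 u s t := by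
  have hu' : ContDiff ℝ 1 (deriv u) := hu.deriv'
  have hu'' : Continuous (deriv (deriv u)) := hu'.continuous_deriv le_rfl
  have hint : ∀ {f : ℝ → E}, Continuous f → IntegrableOn f (Ioo s t) := fun hf =>
    (hf.integrableOn_Icc).mono_set Ioo_subset_Icc_self
  refine ⟨.of_hasDerivAt (hint hu'.continuous) fun x _ => ?_,
    .of_hasDerivAt (hint hu'') fun x _ => ?_, ?_⟩
  · exact (hu.differentiable two_ne_zero x).hasDerivAt
  · exact (hu'.differentiable one_ne_zero x).hasDerivAt
  · exact (memLp_top_of_hasEndLimits hu''.continuousOn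
      ⟨⟨_, hu''.continuousWithinAt⟩, _, hu''.continuousWithinAt⟩).mono_exponent le_top

/-- The function is the cubic Hermite interpolant of the boundary data. -/
theorem exists_memH2_trace_eq (hst : s < t) (p q : E × E) :
    ∃ u : ℝ → E, MemH2 u s t ∧ rightTrace u s = p ∧ leftTrace u t = q := by
  obtain ⟨α, β⟩ := p
  obtain ⟨α', β'⟩ := q
  have hL : t - s ≠ 0 := (sub_pos.2 hst).ne'
  set L := t - s
  let A : E := (3 / L ^ 2) • (α' - α - L • β) - (1 / L) • (β' - β)
  let B : E := (1 / L ^ 2) • (β' - β) - (2 / L ^ 3) • (α' - α - L • β)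
  let u : ℝ → E := fun x => α + (x - s) • β + (x - s) ^ 2 • A + (x - s) ^ 3 • B
  have hu : ContDiff ℝ 2 u := by fun_prop
  have hderiv (x : ℝ) : deriv u x = β + (2 * (x - s)) • A + (3 * (x - s) ^ 2) • B := by
    have hsub : HasDerivAt (fun x : ℝ => x - s) 1 x := (hasDerivAt_id x).sub_const s
    refine HasDerivAt.deriv (((((hsub.smul_const β).const_add α).add
      ((hsub.pow 2).smul_const A)).add ((hsub.pow 3).smul_const B)).congr_deriv ?_)
    simp only [one_smul, Nat.add_one_sub_one, pow_one, mul_one, Nat.cast_ofNat]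
  refine ⟨u, memH2_of_contDiff hu s t, ?_, ?_⟩
  · rw [rightTrace_of_contDiff hu, hderiv]
    simp [u]
  · rw [leftTrace_of_contDiff hu, hderiv]
    ext
    · change α + L • β + L ^ 2 • A + L ^ 3 • B = α'
      simp only [A, B]
      match_scalars <;> field_simp <;> ring
    · change β + (2 * L) • A + (3 * L ^ 2) • B = β'
      simp only [A, B]
      match_scalars <;> field_simp <;> ring

theorem exists_memH2_deriv_deriv_ae_eq (hst : s < t)
    (hφ : MemLp φ 2 (volume.restrict (Ioo s t))) :
    ∃ u, MemH2 u s t ∧ deriv (deriv u) =ᵐ[volume.restrict (Ioo s t)] φ ∧ rightTrace u s = 0 := by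
  obtain ⟨w, hw, hw0⟩ := exists_isPrimitiveOn_rightLim_eq hst (hφ.integrable one_le_two) 0
  obtain ⟨u, hu, hu0⟩ := exists_isPrimitiveOn_rightLim_eq hst
    ((hw.memLp hst 2).integrable one_le_two) 0
  refine ⟨u, hu.memH2 hw hφ, hu.deriv_deriv_ae_eq hw, ?_⟩
  rw [rightTrace, hu0, rightLim_congr hst (hw.hasEndLimits hst).1
    (hu.eqOn_deriv hw.continuousOn), hw0]
  rfl

end SobolevTwo

section Green

variable {𝕜 : Type*} [RCLike 𝕜] {u v : ℝ → 𝕜} {s t : ℝ}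

/-- The sesquilinear form through which boundary data `p = (u, u')` and `q = (v, v')` enter Green's
formula. -/
def bracket (p q : 𝕜 × 𝕜) : 𝕜 := p.2 * conj q.1 - p.1 * conj q.2

theorem bracket_zero_left (q : 𝕜 × 𝕜) : bracket 0 q = 0 := by
  simp only [bracket, Prod.fst_zero, Prod.snd_zero, zero_mul, sub_zero]

theorem continuous_bracket : Continuous fun p : (𝕜 × 𝕜) × 𝕜 × 𝕜 => bracket p.1 p.2 := by
  simp only [bracket]
  have hconj : Continuous (conj : 𝕜 → 𝕜) := RCLike.continuous_conj
  fun_prop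

theorem MemH2.isPrimitiveOn_bracket (hu : MemH2 u s t) (hv : MemH2 v s t) (hst : s < t) :
    IsPrimitiveOn (fun x => bracket (u x, deriv u x) (v x, deriv v x))
      (fun x => deriv (deriv u) x * conj (v x) - u x * conj (deriv (deriv v) x)) s t := by
  have hconj {f φ : ℝ → 𝕜} (h : IsPrimitiveOn f φ s t) :
      IsPrimitiveOn (fun x => conj (f x)) (fun x => conj (φ x)) s t :=
    h.continuousLinearMap_comp (RCLike.conjCLE (K := 𝕜)).toContinuousLinearMap
  refine ((hu.isPrimitiveOn_deriv.mul (hconj hv.isPrimitiveOn) hst).sub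
    (hu.isPrimitiveOn.mul (hconj hv.isPrimitiveOn_deriv) hst)).congr (eqOn_refl _ _)
    (.of_forall fun x => ?_)
  ring

theorem integrable_mul_conj {α : Type*} [MeasurableSpace α] {μ : Measure α} {f g : α → 𝕜}
    (hf : MemLp f 2 μ) (hg : MemLp g 2 μ) : Integrable (fun x => f x * conj (g x)) μ :=
  hf.integrable_mul hg.star

theorem MemH2.green (hu : MemH2 u s t) (hv : MemH2 v s t) (hst : s < t) :
    (∫ x in Ioo s t, deriv (deriv u) x * conj (v x)) -
        ∫ x in Ioo s t, u x * conj (deriv (deriv v) x) =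
      bracket (leftTrace u t) (leftTrace v t) - bracket (rightTrace u s) (rightTrace v s) := by
  rw [← integral_sub (integrable_mul_conj hu.memLp_deriv_deriv (hv.memLp_two hst))
      (integrable_mul_conj (hu.memLp_two hst) hv.memLp_deriv_deriv),
    (hu.isPrimitiveOn_bracket hv hst).integral_eq_leftLim_sub_rightLim hst]
  congr 1
  · exact leftLim_eq_of_tendsto ((continuous_bracket.tendsto _).comp
      ((hu.tendsto_leftTrace hst).prodMk_nhds (hv.tendsto_leftTrace hst)))
  · exact rightLim_eq_of_tendsto ((continuous_bracket.tendsto _).comp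
      ((hu.tendsto_rightTrace hst).prodMk_nhds (hv.tendsto_rightTrace hst)))

end Green

section WeakSecondDerivative

variable {𝕜 : Type*} [RCLike 𝕜] {s t : ℝ}

theorem ae_eq_sum_of_forall_integral_eq_zero {α ι : Type*} [MeasurableSpace α] {μ : Measure α}
    [Fintype ι] {e : ι → α → 𝕜} {f : α → 𝕜} (he : ∀ i, MemLp (e i) 2 μ) (hf : MemLp f 2 μ)
    (h : ∀ φ, MemLp φ 2 μ → (∀ i, ∫ x, φ x * conj (e i x) ∂μ = 0) →
      ∫ x, φ x * conj (f x) ∂μ = 0) :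
    ∃ c : ι → 𝕜, f =ᵐ[μ] fun x => ∑ i, c i * e i x := by
  have hinner {g : α → 𝕜} (hg : MemLp g 2 μ) (φ : Lp 𝕜 2 μ) :
      inner 𝕜 (hg.toLp g) φ = ∫ x, φ x * conj (g x) ∂μ := by
    rw [L2.inner_def]
    refine integral_congr_ae ?_
    filter_upwards [hg.coeFn_toLp] with x hx
    rw [hx, RCLike.inner_apply]
  have hmem : hf.toLp f ∈ Submodule.span 𝕜 (range fun i => (he i).toLp (e i)) := by
    refine mem_span_range_of_forall_inner_eq_zero fun φ hφ => ?_
    rw [inner_eq_zero_symm, hinner]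
    exact h φ (Lp.memLp φ) fun i => (hinner (he i) φ).symm.trans (hφ i)
  obtain ⟨c, hc⟩ := (Submodule.mem_span_range_iff_exists_fun 𝕜).1 hmem
  refine ⟨c, ?_⟩
  have hterm : ∀ᵐ x ∂μ, ∀ i, (c i • (he i).toLp (e i) : Lp 𝕜 2 μ) x = c i * e i x :=
    ae_all_iff.2 fun i => by
      filter_upwards [Lp.coeFn_smul (c i) ((he i).toLp (e i)), (he i).coeFn_toLp] with x hsmul hx
      rw [hsmul, Pi.smul_apply, hx, smul_eq_mul]
  filter_upwards [hf.coeFn_toLp, Lp.coeFn_finsetSum Finset.univ fun i => c i • (he i).toLp (e i),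
    hterm] with x hfx hsum hx
  rw [← hfx, ← hc, hsum, Finset.sum_apply]
  exact Finset.sum_congr rfl fun i _ => hx i

theorem exists_memH2_trace_eq_zero (hst : s < t) {φ : ℝ → 𝕜}
    (hφ : MemLp φ 2 (volume.restrict (Ioo s t))) (h0 : ∫ x in Ioo s t, φ x = 0)
    (h1 : ∫ x in Ioo s t, φ x * (x : 𝕜) = 0) :
    ∃ u, MemH2 u s t ∧ deriv (deriv u) =ᵐ[volume.restrict (Ioo s t)] φ ∧
      rightTrace u s = 0 ∧ leftTrace u t = 0 := by
  obtain ⟨u, hu, huφ, hus⟩ := exists_memH2_deriv_deriv_ae_eq hst hφ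
  have hgreen (a b : ℝ) : ∫ x in Ioo s t, φ x * ((a + b * x : ℝ) : 𝕜) =
      (leftTrace u t).2 * ((a + b * t : ℝ) : 𝕜) - (leftTrace u t).1 * (b : 𝕜) := by
    have hv : ContDiff ℝ 2 fun x : ℝ => ((a + b * x : ℝ) : 𝕜) :=
      (RCLike.ofRealCLM (K := 𝕜)).contDiff.comp (by fun_prop)
    have hderiv : deriv (fun x : ℝ => ((a + b * x : ℝ) : 𝕜)) = fun _ => (b : 𝕜) := by
      funext x
      have hb : HasDerivAt (fun x : ℝ => a + b * x) b x := by
        simpa using ((hasDerivAt_id x).const_mul b).const_add a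
      exact ((RCLike.ofRealCLM (K := 𝕜)).hasFDerivAt.comp_hasDerivAt x hb).deriv
    have := hu.green (memH2_of_contDiff hv s t) hst
    rw [hus, bracket_zero_left, leftTrace_of_contDiff hv, hderiv] at this
    simp only [deriv_const, map_zero, mul_zero, integral_zero, sub_zero, bracket,
      RCLike.conj_ofReal] at this
    rw [← this]
    exact integral_congr_ae (huφ.mono fun x hx => by simp only [hx])
  have hderiv_zero : (leftTrace u t).2 = 0 := by simpa [h0] using (hgreen 1 0).symm
  have hvalue_zero : (leftTrace u t).1 = 0 := by simpa [h1, hderiv_zero] using (hgreen 0 1).symm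
  exact ⟨u, hu, huφ, hus, Prod.ext hvalue_zero hderiv_zero⟩

/-- The lemma of du Bois-Reymond for second derivatives. -/
theorem ae_eq_affine_of_forall_integral_eq_zero (hst : s < t) {f : ℝ → 𝕜}
    (hf : MemLp f 2 (volume.restrict (Ioo s t)))
    (h : ∀ u, MemH2 u s t → rightTrace u s = 0 → leftTrace u t = 0 →
      ∫ x in Ioo s t, deriv (deriv u) x * conj (f x) = 0) :
    ∃ a b : 𝕜, f =ᵐ[volume.restrict (Ioo s t)] fun x => a + b * x := by
  let e : Fin 2 → ℝ → 𝕜 := ![fun _ => 1, fun x => (x : 𝕜)]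
  have he : ∀ i, MemLp (e i) 2 (volume.restrict (Ioo s t)) := Fin.forall_fin_two.2
    ⟨memLp_const 1, (memH2_of_contDiff (RCLike.ofRealCLM (K := 𝕜)).contDiff s t).memLp_two hst⟩
  obtain ⟨c, hc⟩ := ae_eq_sum_of_forall_integral_eq_zero he hf fun φ hφ hφe => by
    obtain ⟨u, hu, huφ, hus, hut⟩ := exists_memH2_trace_eq_zero hst hφ
      (by simpa [e] using hφe 0) (by simpa [e] using hφe 1)
    rw [← h u hu hus hut]
    exact integral_congr_ae (huφ.mono fun x hx => by simp only [hx])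
  refine ⟨c 0, c 1, hc.trans (.of_forall fun x => ?_)⟩
  simp only [e, Fin.sum_univ_two, Matrix.cons_val_zero, Matrix.cons_val_one, mul_one]

theorem exists_memH2_of_forall_integral_eq (hst : s < t) {g r : ℝ → 𝕜}
    (hg : MemLp g 2 (volume.restrict (Ioo s t))) (hr : MemLp r 2 (volume.restrict (Ioo s t)))
    (h : ∀ u, MemH2 u s t → rightTrace u s = 0 → leftTrace u t = 0 →
      ∫ x in Ioo s t, deriv (deriv u) x * conj (g x) = ∫ x in Ioo s t, u x * conj (r x)) :
    ∃ v, MemH2 v s t ∧ g =ᵐ[volume.restrict (Ioo s t)] v ∧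
      deriv (deriv v) =ᵐ[volume.restrict (Ioo s t)] r := by
  obtain ⟨w, hw, hwr, -⟩ := exists_memH2_deriv_deriv_ae_eq hst hr
  have hwL := hw.memLp_two hst
  obtain ⟨a, b, hab⟩ := ae_eq_affine_of_forall_integral_eq_zero hst (hg.sub hwL)
    fun u hu hus hut => by
      have hgreen := hu.green hw hst
      rw [hus, hut, bracket_zero_left, bracket_zero_left, sub_self, sub_eq_zero] at hgreen
      have hur : ∫ x in Ioo s t, u x * conj (deriv (deriv w) x) =
          ∫ x in Ioo s t, u x * conj (r x) :=
        integral_congr_ae (hwr.mono fun x hx => by simp only [hx])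
      simp only [Pi.sub_apply, map_sub, mul_sub]
      rw [integral_sub (integrable_mul_conj hu.memLp_deriv_deriv hg)
        (integrable_mul_conj hu.memLp_deriv_deriv hwL), hgreen, hur, h u hu hus hut, sub_self]
  have hderiv (x : ℝ) : HasDerivAt (fun x : ℝ => a + b * (x : 𝕜)) b x := by
    simpa using ((RCLike.ofRealCLM (K := 𝕜)).hasDerivAt.const_mul b).const_add a
  have hline : IsPrimitiveOn (fun x : ℝ => a + b * (x : 𝕜)) (fun _ => b) s t :=
    .of_hasDerivAt (integrable_const b) fun x _ => hderiv x
  have hslope : IsPrimitiveOn (fun _ => b) (fun _ => 0) s t :=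
    .of_hasDerivAt (integrable_const 0) fun x _ => hasDerivAt_const x b
  have hv := hw.isPrimitiveOn.add hline
  have hv' := hw.isPrimitiveOn_deriv.add hslope
  simp only [add_zero] at hv'
  refine ⟨_, hv.memH2 hv' hw.memLp_deriv_deriv, ?_, (hv.deriv_deriv_ae_eq hv').trans hwr⟩
  filter_upwards [hab] with x hx
  rw [← hx, Pi.sub_apply, add_sub_cancel]

end WeakSecondDerivative

section BoundaryForms

/-- The boundary form `c u + d u'`, evaluated at the boundary data `p = (u, u')`. -/
def realForm {𝕜 : Type*} [RCLike 𝕜] (c d : ℝ) (p : 𝕜 × 𝕜) : 𝕜 := (c : 𝕜) * p.1 + (d : 𝕜) * p.2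

variable {𝕜 : Type*} [RCLike 𝕜] (c d c' d' : ℝ)

theorem realForm_mul_conj_sub (p q : 𝕜 × 𝕜) :
    realForm c d p * conj (realForm c' d' q) - realForm c' d' p * conj (realForm c d q) =
      ((d * c' - c * d' : ℝ) : 𝕜) * bracket p q := by
  simp only [realForm, bracket, map_add, map_mul, RCLike.conj_ofReal]
  push_cast
  ring

theorem exists_realForm_eq (hdet : d * c' - c * d' ≠ 0) (x y : 𝕜) :
    ∃ p, realForm c d p = x ∧ realForm c' d' p = y := by
  have hdet' : (d : 𝕜) * c' - c * d' ≠ 0 := by exact_mod_cast hdet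
  refine ⟨((d * y - d' * x) / (d * c' - c * d'), (c' * x - c * y) / (d * c' - c * d')), ?_, ?_⟩ <;>
  · simp only [realForm]
    rw [mul_div_assoc', mul_div_assoc', ← add_div, div_eq_iff hdet']
    ring

end BoundaryForms

namespace TransmissionProblem

noncomputable section

variable {n : ℕ} {P : TransmissionProblem n} {u v : ℝ → ℂ} {F G K : P.H}

section PiecewiseSobolev

instance (k : Fin (n + 1)) : IsFiniteMeasure (P.pieceMeasure k) :=
  inferInstanceAs (IsFiniteMeasure (volume.restrict (Ioo _ _)))

theorem ρ_sq_ne_zero (k : Fin (n + 1)) : (P.ρ k : ℂ) ^ 2 ≠ 0 := by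
  exact_mod_cast (P.ρ_sq_pos k).ne'

theorem continuousOn_ofReal_q (k : Fin (n + 1)) :
    ContinuousOn (fun x => (P.q x : ℂ)) (P.piece k) :=
  Complex.continuous_ofReal.comp_continuousOn (P.q_continuousOn k)

theorem memLp_q_mul {k : Fin (n + 1)} {f : ℝ → ℂ} (hf : MemLp f 2 (P.pieceMeasure k)) :
    MemLp (fun x => P.q x * f x) 2 (P.pieceMeasure k) := by
  obtain ⟨⟨l, hl⟩, m, hm⟩ := P.q_limits k
  exact hf.mul (memLp_top_of_hasEndLimits (continuousOn_ofReal_q k)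
    ⟨⟨_, (Complex.continuous_ofReal.tendsto l).comp hl⟩, _,
      (Complex.continuous_ofReal.tendsto m).comp hm⟩)

/-- The value of `u''` that `ℓ u = h` forces on the `k`-th piece when `u = g`. -/
def secondDeriv (P : TransmissionProblem n) (k : Fin (n + 1)) (g h : ℝ → ℂ) (x : ℝ) : ℂ :=
  ((P.ρ k : ℂ) ^ 2)⁻¹ * (P.q x * g x - h x)

theorem ell_eq_iff {k : Fin (n + 1)} {h : ℝ → ℂ} {x : ℝ} :
    P.ell k u x = h x ↔ deriv (deriv u) x = P.secondDeriv k u h x := by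
  rw [ell, secondDeriv, eq_inv_mul_iff_mul_eq₀ (ρ_sq_ne_zero k)]
  constructor <;> intro h <;> linear_combination -h

theorem memLp_secondDeriv {k : Fin (n + 1)} {g h : ℝ → ℂ} (hg : MemLp g 2 (P.pieceMeasure k))
    (hh : MemLp h 2 (P.pieceMeasure k)) : MemLp (P.secondDeriv k g h) 2 (P.pieceMeasure k) :=
  ((memLp_q_mul hg).sub hh).const_mul _

theorem continuousOn_secondDeriv {k : Fin (n + 1)} {g h : ℝ → ℂ} (hg : ContinuousOn g (P.piece k))
    (hh : ContinuousOn h (P.piece k)) : ContinuousOn (P.secondDeriv k g h) (P.piece k) :=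
  continuousOn_const.mul (((continuousOn_ofReal_q k).mul hg).sub hh)

/-- `u` belongs to `H²` on every piece; it need not satisfy any transmission condition. -/
def PiecewiseH2 (P : TransmissionProblem n) (u : ℝ → ℂ) : Prop :=
  ∀ k : Fin (n + 1), MemH2 u (P.ξ k.castSucc) (P.ξ k.succ)

namespace PiecewiseH2

theorem memLp (hu : P.PiecewiseH2 u) (k : Fin (n + 1)) : MemLp u 2 (P.pieceMeasure k) :=
  (hu k).memLp_two (ξ_lt k)

theorem memLp_ell (hu : P.PiecewiseH2 u) (k : Fin (n + 1)) :
    MemLp (P.ell k u) 2 (P.pieceMeasure k) :=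
  ((hu k).memLp_deriv_deriv.const_mul _).add (memLp_q_mul (hu.memLp k))

theorem represents (hu : P.PiecewiseH2 u) (h₁ : ∀ i, P.transδ i u = 0)
    (h₂ : ∀ i, P.transγ i u = 0) (hF : ∀ k, fn F k =ᵐ[P.pieceMeasure k] u)
    (hA : cA F = P.Ba' u) (hB : cB F = -P.Bb' u) : P.Represents u F where
  diff k := (hu k).differentiableOn
  ac k := (hu k).isPrimitiveOn.locallyAC
  ac' k := (hu k).isPrimitiveOn_deriv.locallyAC
  lim k := (hu k).isPrimitiveOn.hasEndLimits (ξ_lt k)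
  lim' k := (hu k).isPrimitiveOn_deriv.hasEndLimits (ξ_lt k)
  ell_memLp := hu.memLp_ell
  trans₁ := h₁
  trans₂ := h₂
  fn_eq := hF
  cA_eq := hA
  cB_eq := hB

theorem exists_represents (hu : P.PiecewiseH2 u) (h₁ : ∀ i, P.transδ i u = 0)
    (h₂ : ∀ i, P.transγ i u = 0) : ∃ F, P.Represents u F :=
  ⟨P.mkH (fun k => (hu.memLp k).toLp u) (P.Ba' u) (-P.Bb' u),
    hu.represents h₁ h₂ (fun k => (hu.memLp k).coeFn_toLp) rfl rfl⟩

end PiecewiseH2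

theorem Represents.piecewiseH2 (h : P.Represents u F) : P.PiecewiseH2 u := fun k => by
  have hu : MemLp u 2 (P.pieceMeasure k) :=
    (memLp_top_of_hasEndLimits (h.diff k).continuousOn (h.lim k)).mono_exponent le_top
  have hu'' : MemLp (deriv (deriv u)) 2 (P.pieceMeasure k) :=
    (memLp_secondDeriv hu (h.ell_memLp k)).ae_eq (.of_forall fun _ => (ell_eq_iff.1 rfl).symm)
  have hu' := isPrimitiveOn_deriv_of_locallyAC (h.ac' k) (hu''.integrable one_le_two)
  exact ⟨isPrimitiveOn_deriv_of_locallyAC (h.ac k) ((hu'.memLp (ξ_lt k) 2).integrable one_le_two),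
    hu', hu''⟩

theorem eq_of_mem_piece {j k : Fin (n + 1)} {x : ℝ} (hj : x ∈ P.piece j) (hk : x ∈ P.piece k) :
    j = k := by
  have not_lt_of_mem {j k : Fin (n + 1)} (hj : x ∈ P.piece j) (hk : x ∈ P.piece k) : ¬j < k :=
    fun hjk => (hj.2.trans_le (P.ξ_strictMono.monotone (Fin.succ_le_castSucc_iff.2 hjk))).not_gt
      hk.1
  exact le_antisymm (not_lt.1 (not_lt_of_mem hk hj)) (not_lt.1 (not_lt_of_mem hj hk))

/-- The function that agrees with `u k` on the `k`-th piece. -/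
def glue (P : TransmissionProblem n) (u : Fin (n + 1) → ℝ → ℂ) (x : ℝ) : ℂ :=
  ∑ k, (P.piece k).indicator (u k) x

theorem eqOn_glue (u : Fin (n + 1) → ℝ → ℂ) (k : Fin (n + 1)) :
    EqOn (P.glue u) (u k) (P.piece k) := fun x hx => by
  rw [glue, Finset.sum_eq_single_of_mem k (Finset.mem_univ k) fun j _ hj =>
    indicator_of_notMem (fun hxj => hj (eq_of_mem_piece hxj hx)) _, indicator_of_mem hx]

section Glue

variable {w : Fin (n + 1) → ℝ → ℂ} (hw : ∀ k, MemH2 (w k) (P.ξ k.castSucc) (P.ξ k.succ))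
include hw

theorem piecewiseH2_glue : P.PiecewiseH2 (P.glue w) := fun k => (hw k).congr (eqOn_glue w k)

theorem rightTrace_glue (k : Fin (n + 1)) :
    rightTrace (P.glue w) (P.ξ k.castSucc) = rightTrace (w k) (P.ξ k.castSucc) :=
  (hw k).rightTrace_congr (ξ_lt k) (eqOn_glue w k)

theorem leftTrace_glue (k : Fin (n + 1)) :
    leftTrace (P.glue w) (P.ξ k.succ) = leftTrace (w k) (P.ξ k.succ) :=
  (hw k).leftTrace_congr (ξ_lt k) (eqOn_glue w k)

end Glue

theorem exists_piecewiseH2_trace_eq (P : TransmissionProblem n) (l r : Fin (n + 1) → ℂ × ℂ) :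
    ∃ u, P.PiecewiseH2 u ∧ (∀ k : Fin (n + 1), rightTrace u (P.ξ k.castSucc) = l k) ∧
      ∀ k : Fin (n + 1), leftTrace u (P.ξ k.succ) = r k := by
  choose w hw hl hr using fun k => exists_memH2_trace_eq (ξ_lt (P := P) k) (l k) (r k)
  exact ⟨P.glue w, piecewiseH2_glue hw, fun k => (rightTrace_glue hw k).trans (hl k),
    fun k => (leftTrace_glue hw k).trans (hr k)⟩

end PiecewiseSobolev

section BoundaryFunctionals

theorem Ba_eq : P.Ba u = realForm P.δ₁ (-P.δ₂) (rightTrace u P.a) := by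
  simp only [Ba, realForm, rightTrace, Complex.coe_algebraMap, Complex.ofReal_neg]
  ring

theorem Ba'_eq : P.Ba' u = realForm P.δ₃ (-P.δ₄) (rightTrace u P.a) := by
  simp only [Ba', realForm, rightTrace, Complex.coe_algebraMap, Complex.ofReal_neg]
  ring

theorem Bb_eq : P.Bb u = realForm P.γ₁ (-P.γ₂) (leftTrace u P.b) := by
  simp only [Bb, realForm, leftTrace, Complex.coe_algebraMap, Complex.ofReal_neg]
  ring

theorem Bb'_eq : P.Bb' u = realForm P.γ₃ (-P.γ₄) (leftTrace u P.b) := by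
  simp only [Bb', realForm, leftTrace, Complex.coe_algebraMap, Complex.ofReal_neg]
  ring

/-- The contribution of the left limits to the first transmission functional. -/
def leftδ (P : TransmissionProblem n) (i : Fin n) (u : ℝ → ℂ) : ℂ :=
  realForm (P.δm0 i) (P.δm1 i) (leftTrace u (P.pt i))

/-- The contribution of the left limits to the second transmission functional. -/
def leftγ (P : TransmissionProblem n) (i : Fin n) (u : ℝ → ℂ) : ℂ :=
  realForm (P.γm0 i) (P.γm1 i) (leftTrace u (P.pt i))

/-- The contribution of the right limits to the first transmission functional. -/
def rightδ (P : TransmissionProblem n) (i : Fin n) (u : ℝ → ℂ) : ℂ :=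
  realForm (P.δp0 i) (P.δp1 i) (rightTrace u (P.pt i))

/-- The contribution of the right limits to the second transmission functional. -/
def rightγ (P : TransmissionProblem n) (i : Fin n) (u : ℝ → ℂ) : ℂ :=
  realForm (P.γp0 i) (P.γp1 i) (rightTrace u (P.pt i))

theorem transδ_eq (i : Fin n) : P.transδ i u = P.leftδ i u + P.rightδ i u := by
  simp only [transδ, leftδ, rightδ, realForm, leftTrace, rightTrace, Complex.coe_algebraMap]
  ring

theorem transγ_eq (i : Fin n) : P.transγ i u = P.leftγ i u + P.rightγ i u := by
  simp only [transγ, leftγ, rightγ, realForm, leftTrace, rightTrace, Complex.coe_algebraMap]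
  ring

theorem κ₁_eq : P.κ₁ = P.δ₃ * P.δ₂ - P.δ₄ * P.δ₁ := Matrix.det_fin_two_of _ _ _ _

theorem κ₂_eq : P.κ₂ = P.γ₃ * P.γ₂ - P.γ₄ * P.γ₁ := Matrix.det_fin_two_of _ _ _ _

theorem θ_zero_one (i : Fin n) : P.θ i 0 1 = P.δp1 i * P.γp0 i - P.δp0 i * P.γp1 i := by
  simp [θ, transMatrix, Matrix.det_fin_two]

theorem θ_two_three (i : Fin n) : P.θ i 2 3 = P.δm1 i * P.γm0 i - P.δm0 i * P.γm1 i := by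
  simp [θ, transMatrix, Matrix.det_fin_two]

theorem κ₁_mul_bracket : (P.κ₁ : ℂ) * bracket (rightTrace u P.a) (rightTrace v P.a) =
    P.Ba' u * conj (P.Ba v) - P.Ba u * conj (P.Ba' v) := by
  rw [Ba_eq, Ba'_eq, Ba_eq, Ba'_eq, realForm_mul_conj_sub, κ₁_eq, RCLike.ofReal_eq_complex_ofReal]
  push_cast
  ring

theorem κ₂_mul_bracket : (P.κ₂ : ℂ) * bracket (leftTrace u P.b) (leftTrace v P.b) =
    P.Bb' u * conj (P.Bb v) - P.Bb u * conj (P.Bb' v) := by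
  rw [Bb_eq, Bb'_eq, Bb_eq, Bb'_eq, realForm_mul_conj_sub, κ₂_eq, RCLike.ofReal_eq_complex_ofReal]
  push_cast
  ring

theorem θ_zero_one_mul_bracket (i : Fin n) :
    (P.θ i 0 1 : ℂ) * bracket (rightTrace u (P.pt i)) (rightTrace v (P.pt i)) =
      P.rightδ i u * conj (P.rightγ i v) - P.rightγ i u * conj (P.rightδ i v) := by
  rw [rightδ, rightγ, rightγ, rightδ, realForm_mul_conj_sub, θ_zero_one]
  rfl

theorem θ_two_three_mul_bracket (i : Fin n) :
    (P.θ i 2 3 : ℂ) * bracket (leftTrace u (P.pt i)) (leftTrace v (P.pt i)) =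
      P.leftδ i u * conj (P.leftγ i v) - P.leftγ i u * conj (P.leftδ i v) := by
  rw [leftδ, leftγ, leftγ, leftδ, realForm_mul_conj_sub, θ_two_three]
  rfl

theorem θ_mul_bracket_sub {i : Fin n} (hδ : P.transδ i u = 0) (hγ : P.transγ i u = 0) :
    (P.θ i 2 3 : ℂ) * bracket (leftTrace u (P.pt i)) (leftTrace v (P.pt i)) -
        P.θ i 0 1 * bracket (rightTrace u (P.pt i)) (rightTrace v (P.pt i)) =
      P.leftδ i u * conj (P.transγ i v) - P.leftγ i u * conj (P.transδ i v) := by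
  rw [transδ_eq, add_comm, ← eq_neg_iff_add_eq_zero] at hδ
  rw [transγ_eq, add_comm, ← eq_neg_iff_add_eq_zero] at hγ
  rw [θ_two_three_mul_bracket, θ_zero_one_mul_bracket, transδ_eq, transγ_eq, hδ, hγ, map_add,
    map_add]
  ring

theorem exists_represents_boundary_eq (P : TransmissionProblem n) (x x' y y' : ℂ)
    (c c' : Fin n → ℂ) :
    ∃ u F, P.Represents u F ∧ (P.Ba u = x ∧ P.Ba' u = x') ∧ (P.Bb u = y ∧ P.Bb' u = y') ∧
      ∀ i, P.leftδ i u = c i ∧ P.leftγ i u = c' i := by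
  obtain ⟨pa, hpa⟩ := exists_realForm_eq P.δ₁ (-P.δ₂) P.δ₃ (-P.δ₄)
    (by linarith [κ₁_eq (P := P), show 0 < P.κ₁ from P.κ₁_pos]) x x'
  obtain ⟨pb, hpb⟩ := exists_realForm_eq P.γ₁ (-P.γ₂) P.γ₃ (-P.γ₄)
    (by linarith [κ₂_eq (P := P), show 0 < P.κ₂ from P.κ₂_pos]) y y'
  choose pm hpm using fun i => exists_realForm_eq (P.δm0 i) (P.δm1 i) (P.γm0 i) (P.γm1 i)
    (θ_two_three (P := P) i ▸ (P.θ_pos i (by decide)).ne') (c i) (c' i)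
  choose pp hpp using fun i => exists_realForm_eq (P.δp0 i) (P.δp1 i) (P.γp0 i) (P.γp1 i)
    (θ_zero_one (P := P) i ▸ (P.θ_pos i (by decide)).ne') (-c i) (-c' i)
  obtain ⟨u, hu, hr, hl⟩ := P.exists_piecewiseH2_trace_eq (Fin.cons pa pp) (Fin.snoc pm pb)
  have ha : rightTrace u P.a = pa := hr 0
  have hb : leftTrace u P.b = pb := (hl (Fin.last n)).trans (Fin.snoc_last ..)
  have hm (i : Fin n) : leftTrace u (P.pt i) = pm i := (hl i.castSucc).trans (Fin.snoc_castSucc ..)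
  have hp (i : Fin n) : rightTrace u (P.pt i) = pp i := hr i.succ
  rw [← ha, ← Ba_eq, ← Ba'_eq] at hpa
  rw [← hb, ← Bb_eq, ← Bb'_eq] at hpb
  have hleft (i : Fin n) : P.leftδ i u = c i ∧ P.leftγ i u = c' i := by
    simpa only [leftδ, leftγ, hm] using hpm i
  have hright (i : Fin n) : P.rightδ i u = -c i ∧ P.rightγ i u = -c' i := by
    simpa only [rightδ, rightγ, hp] using hpp i
  obtain ⟨F, hF⟩ := hu.exists_represents
    (fun i => by rw [transδ_eq, (hleft i).1, (hright i).1, add_neg_cancel])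
    (fun i => by rw [transγ_eq, (hleft i).2, (hright i).2, add_neg_cancel])
  exact ⟨u, F, hF, hpa, hpb, hleft⟩

end BoundaryFunctionals

section LagrangeIdentity

theorem integral_ell_mul_conj {k : Fin (n + 1)} {g : ℝ → ℂ}
    (hu : MemH2 u (P.ξ k.castSucc) (P.ξ k.succ)) (hg : MemLp g 2 (P.pieceMeasure k)) :
    ∫ x in P.piece k, P.ell k u x * conj (g x) =
      -((P.ρ k : ℂ) ^ 2) * (∫ x in P.piece k, deriv (deriv u) x * conj (g x)) +
        ∫ x in P.piece k, u x * conj (P.q x * g x) := by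
  have hu₂ : MemLp u 2 (P.pieceMeasure k) := hu.memLp_two (ξ_lt k)
  have hu'' : MemLp (deriv (deriv u)) 2 (P.pieceMeasure k) := hu.memLp_deriv_deriv
  rw [← integral_const_mul, ← integral_add ((integrable_mul_conj hu'' hg).const_mul _)
    (integrable_mul_conj hu₂ (memLp_q_mul hg))]
  refine integral_congr_ae (.of_forall fun x => ?_)
  simp only [ell, map_mul, Complex.conj_ofReal]
  ring

theorem integral_mul_conj_ell {k : Fin (n + 1)} {g : ℝ → ℂ}
    (hg : MemLp g 2 (P.pieceMeasure k)) (hv : MemH2 v (P.ξ k.castSucc) (P.ξ k.succ)) :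
    ∫ x in P.piece k, g x * conj (P.ell k v x) =
      -((P.ρ k : ℂ) ^ 2) * (∫ x in P.piece k, g x * conj (deriv (deriv v) x)) +
        ∫ x in P.piece k, g x * conj (P.q x * v x) := by
  rw [← integral_const_mul, ← integral_add
    ((integrable_mul_conj hg hv.memLp_deriv_deriv).const_mul _)
    (integrable_mul_conj hg (memLp_q_mul (hv.memLp_two (ξ_lt k))))]
  refine integral_congr_ae (.of_forall fun x => ?_)
  simp only [ell, map_add, map_mul, map_neg, map_pow, Complex.conj_ofReal]
  ring

theorem green_piece {k : Fin (n + 1)} (hu : MemH2 u (P.ξ k.castSucc) (P.ξ k.succ))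
    (hv : MemH2 v (P.ξ k.castSucc) (P.ξ k.succ)) :
    ((1 / P.ρ k ^ 2 * P.thetaProd k : ℝ) : ℂ) * (∫ x in P.piece k, P.ell k u x * conj (v x)) -
        ((1 / P.ρ k ^ 2 * P.thetaProd k : ℝ) : ℂ) * (∫ x in P.piece k, u x * conj (P.ell k v x)) =
      P.thetaProd k * bracket (rightTrace u (P.ξ k.castSucc)) (rightTrace v (P.ξ k.castSucc)) -
        P.thetaProd k * bracket (leftTrace u (P.ξ k.succ)) (leftTrace v (P.ξ k.succ)) := by
  have hgreen : (∫ x in P.piece k, deriv (deriv u) x * conj (v x)) -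
      ∫ x in P.piece k, u x * conj (deriv (deriv v) x) = _ := hu.green hv (ξ_lt k)
  have hρ : (P.ρ k : ℂ) ≠ 0 := pow_ne_zero_iff two_ne_zero |>.1 (ρ_sq_ne_zero k)
  rw [← mul_sub, integral_ell_mul_conj hu (hv.memLp_two (ξ_lt k)),
    integral_mul_conj_ell (hu.memLp_two (ξ_lt k)) hv, add_sub_add_right_eq_sub, ← mul_sub, hgreen]
  push_cast
  field_simp
  ring

/-- The factors of `thetaProd` that do not belong to the `i`-th interior point. -/
def thetaRest (P : TransmissionProblem n) (i : Fin n) : ℝ :=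
  (∏ j with j < i, P.θ j 0 1) * ∏ j with i < j, P.θ j 2 3

theorem thetaRest_pos (i : Fin n) : 0 < P.thetaRest i :=
  mul_pos (Finset.prod_pos fun j _ => P.θ_pos j (by decide))
    (Finset.prod_pos fun j _ => P.θ_pos j (by decide))

theorem thetaProd_castSucc (i : Fin n) :
    P.thetaProd i.castSucc = P.thetaRest i * P.θ i 2 3 := by
  have hinsert : Finset.univ.filter (fun j : Fin n => i.castSucc.val ≤ j.val) =
      insert i (Finset.univ.filter fun j => i < j) := by
    grind [Fin.val_castSucc]
  rw [thetaProd, hinsert, Finset.prod_insert (by simp), thetaRest, mul_left_comm, mul_comm]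
  rfl

theorem thetaProd_succ (i : Fin n) : P.thetaProd i.succ = P.thetaRest i * P.θ i 0 1 := by
  have hinsert : Finset.univ.filter (fun j : Fin n => j.val < i.succ.val) =
      insert i (Finset.univ.filter fun j => j < i) := by
    grind
  rw [thetaProd, hinsert, Finset.prod_insert (by simp), thetaRest, mul_assoc, mul_comm]
  rfl

theorem thetaProd_zero : P.thetaProd 0 = ∏ i, P.θ i 2 3 := by simp [thetaProd]

theorem thetaProd_last : P.thetaProd (Fin.last n) = ∏ i, P.θ i 0 1 := by
  simp [thetaProd, Finset.filter_false_of_mem]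

theorem green (hu : P.PiecewiseH2 u) (hv : P.PiecewiseH2 v) :
    (∑ k, ((1 / P.ρ k ^ 2 * P.thetaProd k : ℝ) : ℂ) *
        ∫ x in P.piece k, P.ell k u x * conj (v x)) -
      ∑ k, ((1 / P.ρ k ^ 2 * P.thetaProd k : ℝ) : ℂ) *
        (∫ x in P.piece k, u x * conj (P.ell k v x)) =
    (∏ i, P.θ i 2 3 : ℝ) * bracket (rightTrace u P.a) (rightTrace v P.a) -
      (∏ i, P.θ i 0 1 : ℝ) * bracket (leftTrace u P.b) (leftTrace v P.b) -
      ∑ i, (P.thetaRest i : ℂ) *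
        (P.θ i 2 3 * bracket (leftTrace u (P.pt i)) (leftTrace v (P.pt i)) -
          P.θ i 0 1 * bracket (rightTrace u (P.pt i)) (rightTrace v (P.pt i))) := by
  rw [← Finset.sum_sub_distrib, Finset.sum_congr rfl fun k _ => green_piece (hu k) (hv k),
    Finset.sum_sub_distrib, Fin.sum_univ_succ, Fin.sum_univ_castSucc, thetaProd_zero,
    thetaProd_last]
  simp only [thetaProd_castSucc, thetaProd_succ, mul_sub, Finset.sum_sub_distrib,
    Complex.ofReal_mul, mul_assoc, ← Fin.succ_castSucc, Fin.castSucc_zero, Fin.succ_last, a, b, pt]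
  ring

/-- `v` represents the function component of `G`, and `ℓ v` that of `L`: the pair `(G, L)` lies in
the graph of the maximal operator, on which no boundary or transmission conditions are imposed. -/
structure MaximalPair (P : TransmissionProblem n) (v : ℝ → ℂ) (G L : P.H) : Prop where
  piecewiseH2 : P.PiecewiseH2 v
  fn_eq : ∀ k, fn G k =ᵐ[P.pieceMeasure k] v
  fn_eq_ell : ∀ k, fn L k =ᵐ[P.pieceMeasure k] P.ell k v

theorem Represents.maximalPair (hu : P.Represents u F) : P.MaximalPair u F hu.image where
  piecewiseH2 := hu.piecewiseH2
  fn_eq := hu.fn_eq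
  fn_eq_ell k := (hu.ell_memLp k).coeFn_toLp

theorem Represents.cA_image (hu : P.Represents u F) : cA hu.image = P.Ba u := rfl

theorem Represents.cB_image (hu : P.Represents u F) : cB hu.image = P.Bb u := rfl

theorem inner_eq_of_ae_eq {f g : Fin (n + 1) → ℝ → ℂ}
    (hF : ∀ k, fn F k =ᵐ[P.pieceMeasure k] f k) (hG : ∀ k, fn G k =ᵐ[P.pieceMeasure k] g k) :
    inner ℂ G F =
      (∑ k, ((1 / P.ρ k ^ 2 * P.thetaProd k : ℝ) : ℂ) *
        ∫ x in P.piece k, f k x * conj (g k x)) +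
      (P.weightA : ℝ) * (cA F * conj (cA G)) + (P.weightB : ℝ) * (cB F * conj (cB G)) := by
  have hint (k : Fin (n + 1)) : ∫ x in P.piece k, fn F k x * conj (fn G k x) =
      ∫ x in P.piece k, f k x * conj (g k x) := by
    refine integral_congr_ae ?_
    filter_upwards [hF k, hG k] with x hf hg
    rw [hf, hg]
  rw [inner_eq]
  simp only [hint]
  rfl

theorem lagrange_identity {L : P.H} (hu : P.Represents u F) (hv : P.MaximalPair v G L) :
    inner ℂ G hu.image - inner ℂ L F =
      (P.weightA : ℝ) *
        (P.Ba u * conj (cA G - P.Ba' v) - P.Ba' u * conj (cA L - P.Ba v)) +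
      (P.weightB : ℝ) *
        (P.Bb u * conj (cB G + P.Bb' v) + P.Bb' u * conj (cB L - P.Bb v)) -
      ∑ i, (P.thetaRest i : ℂ) *
        (P.leftδ i u * conj (P.transγ i v) - P.leftγ i u * conj (P.transδ i v)) := by
  have hgreen := green hu.piecewiseH2 hv.piecewiseH2
  simp only [θ_mul_bracket_sub (hu.trans₁ _) (hu.trans₂ _)] at hgreen
  have hA : ((∏ i, P.θ i 2 3 : ℝ) : ℂ) = (P.weightA : ℝ) * P.κ₁ := by
    rw [← Complex.ofReal_mul, weightA, div_mul_cancel₀ _ (show 0 < P.κ₁ from P.κ₁_pos).ne']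
  have hB : ((∏ i, P.θ i 0 1 : ℝ) : ℂ) = (P.weightB : ℝ) * P.κ₂ := by
    rw [← Complex.ofReal_mul, weightB, div_mul_cancel₀ _ (show 0 < P.κ₂ from P.κ₂_pos).ne']
  rw [hA, hB, mul_assoc, mul_assoc, κ₁_mul_bracket, κ₂_mul_bracket] at hgreen
  rw [inner_eq_of_ae_eq hu.maximalPair.fn_eq_ell hv.fn_eq,
    inner_eq_of_ae_eq hu.fn_eq hv.fn_eq_ell, hu.cA_image, hu.cB_image, hu.cA_eq, hu.cB_eq]
  simp only [map_add, map_sub]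
  linear_combination hgreen

theorem isFormalAdjoint_R : P.R.IsFormalAdjoint P.R := by
  intro G F
  obtain ⟨v, hv⟩ := G.2
  obtain ⟨u, hu⟩ := F.2
  rw [R_apply G hv, R_apply F hu, eq_comm, ← sub_eq_zero, lagrange_identity hu hv.maximalPair]
  simp [hv.cA_image, hv.cB_image, hv.cA_eq, hv.cB_eq, hv.trans₁, hv.trans₂]

end LagrangeIdentity

section SelfAdjoint

theorem eqOn_ell {k : Fin (n + 1)} (h : EqOn u v (P.piece k)) :
    EqOn (P.ell k u) (P.ell k v) (P.piece k) := fun x hx => by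
  simp only [ell, (h.deriv isOpen_Ioo).deriv isOpen_Ioo hx, h hx]

theorem exists_represents_eqOn_piece {k : Fin (n + 1)}
    (hu : MemH2 u (P.ξ k.castSucc) (P.ξ k.succ)) (hr : rightTrace u (P.ξ k.castSucc) = 0)
    (hl : leftTrace u (P.ξ k.succ) = 0) :
    ∃ w F, P.Represents w F ∧ EqOn w u (P.piece k) ∧ (∀ j ≠ k, EqOn w 0 (P.piece j)) ∧
      (P.Ba w = 0 ∧ P.Ba' w = 0) ∧ (P.Bb w = 0 ∧ P.Bb' w = 0) := by
  let w : Fin (n + 1) → ℝ → ℂ := Pi.single k u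
  have hw (j : Fin (n + 1)) : MemH2 (w j) (P.ξ j.castSucc) (P.ξ j.succ) ∧
      rightTrace (w j) (P.ξ j.castSucc) = 0 ∧ leftTrace (w j) (P.ξ j.succ) = 0 := by
    rcases eq_or_ne j k with rfl | hj
    · simpa only [w, Pi.single_eq_same] using ⟨hu, hr, hl⟩
    · have h0 : ContDiff ℝ 2 (0 : ℝ → ℂ) := contDiff_const
      simp only [w, Pi.single_eq_of_ne hj, rightTrace_of_contDiff h0, leftTrace_of_contDiff h0]
      exact ⟨memH2_of_contDiff h0 _ _, by simp, by simp⟩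
  have hright (j : Fin (n + 1)) := (rightTrace_glue (fun j => (hw j).1) j).trans (hw j).2.1
  have hleft (j : Fin (n + 1)) := (leftTrace_glue (fun j => (hw j).1) j).trans (hw j).2.2
  have ha : rightTrace (P.glue w) P.a = 0 := hright 0
  have hb : leftTrace (P.glue w) P.b = 0 := hleft (Fin.last n)
  have hp (i : Fin n) : rightTrace (P.glue w) (P.pt i) = 0 := hright i.succ
  have hm (i : Fin n) : leftTrace (P.glue w) (P.pt i) = 0 := hleft i.castSucc
  obtain ⟨F, hF⟩ := (piecewiseH2_glue fun j => (hw j).1).exists_represents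
    (fun i => by simp [transδ_eq, leftδ, rightδ, hp, hm, realForm])
    (fun i => by simp [transγ_eq, leftγ, rightγ, hp, hm, realForm])
  refine ⟨_, F, hF, ?_, fun j hj => ?_, ?_, ?_⟩
  · simpa only [w, Pi.single_eq_same] using eqOn_glue w k
  · simpa only [w, Pi.single_eq_of_ne hj] using eqOn_glue w j
  · simp [Ba_eq, Ba'_eq, ha, realForm]
  · simp [Bb_eq, Bb'_eq, hb, realForm]

theorem integral_ell_mul_conj_eq_of_isAdjointPair (h : IsAdjointPair P.R G K) {k : Fin (n + 1)}
    (hu : MemH2 u (P.ξ k.castSucc) (P.ξ k.succ))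
    (hr : rightTrace u (P.ξ k.castSucc) = 0) (hl : leftTrace u (P.ξ k.succ) = 0) :
    ∫ x in P.piece k, P.ell k u x * conj (fn G k x) =
      ∫ x in P.piece k, u x * conj (fn K k x) := by
  obtain ⟨w, F, hF, hwu, hw0, ⟨ha, ha'⟩, hb, hb'⟩ := exists_represents_eqOn_piece hu hr hl
  have hinner := h ⟨F, w, hF⟩
  rw [R_apply _ hF, inner_eq_of_ae_eq hF.fn_eq fun _ => .rfl,
    inner_eq_of_ae_eq hF.maximalPair.fn_eq_ell fun _ => .rfl,
    hF.cA_eq, hF.cB_eq, hF.cA_image, hF.cB_image, ha, ha', hb, hb',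
    Fintype.sum_eq_single k fun j hj => ?_, Fintype.sum_eq_single k fun j hj => ?_] at hinner
  · simp only [neg_zero, zero_mul, mul_zero, add_zero] at hinner
    have hweight := mul_left_cancel₀ (Complex.ofReal_ne_zero.2 (P.weight k).2.ne') hinner
    have hell : ∫ x in P.piece k, P.ell k w x * conj (fn G k x) =
        ∫ x in P.piece k, P.ell k u x * conj (fn G k x) :=
      setIntegral_congr_fun measurableSet_Ioo fun x hx => by simp only [eqOn_ell hwu hx]
    rw [← hell, ← hweight]
    exact setIntegral_congr_fun measurableSet_Ioo fun x hx => by simp only [hwu hx]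
  · rw [setIntegral_eq_zero_of_forall_eq_zero fun x hx => ?_, mul_zero]
    rw [eqOn_ell (hw0 j hj) hx]
    simp [ell]
  · rw [setIntegral_eq_zero_of_forall_eq_zero fun x hx => ?_, mul_zero]
    simp [hw0 j hj hx]

theorem exists_maximalPair_of_isAdjointPair (h : IsAdjointPair P.R G K) :
    ∃ v, P.MaximalPair v G K := by
  have hpiece (k : Fin (n + 1)) : ∃ v, MemH2 v (P.ξ k.castSucc) (P.ξ k.succ) ∧
      fn G k =ᵐ[P.pieceMeasure k] v ∧
      deriv (deriv v) =ᵐ[P.pieceMeasure k] P.secondDeriv k (fn G k) (fn K k) := by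
    have hG : MemLp (fn G k) 2 (P.pieceMeasure k) := Lp.memLp _
    have hK : MemLp (fn K k) 2 (P.pieceMeasure k) := Lp.memLp _
    refine exists_memH2_of_forall_integral_eq (ξ_lt k) hG (memLp_secondDeriv hG hK)
      fun u hu hr hl => ?_
    have hu₂ : MemLp u 2 (P.pieceMeasure k) := hu.memLp_two (ξ_lt k)
    have hweak := integral_ell_mul_conj_eq_of_isAdjointPair h hu hr hl
    rw [integral_ell_mul_conj hu hG, ← eq_sub_iff_add_eq, ← integral_sub
      (integrable_mul_conj hu₂ hK) (integrable_mul_conj hu₂ (memLp_q_mul hG)), neg_mul,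
      neg_eq_iff_eq_neg, ← eq_inv_mul_iff_mul_eq₀ (ρ_sq_ne_zero k), ← integral_neg,
      ← integral_const_mul] at hweak
    refine hweak.trans (integral_congr_ae (.of_forall fun x => ?_))
    simp only [secondDeriv, map_mul, map_sub, map_inv₀, map_pow, Complex.conj_ofReal]
    ring
  choose v hv hG hv'' using hpiece
  have hglue (k : Fin (n + 1)) : fn G k =ᵐ[P.pieceMeasure k] P.glue v :=
    (hG k).trans (ae_restrict_of_forall_mem measurableSet_Ioo (eqOn_glue v k).symm)
  refine ⟨P.glue v, piecewiseH2_glue hv, hglue, fun k => ?_⟩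
  filter_upwards [hG k, hv'' k, ae_restrict_mem measurableSet_Ioo] with x hx hx'' hxk
  rw [eqOn_ell (eqOn_glue v k) hxk, eq_comm, ell_eq_iff, hx'', secondDeriv, secondDeriv, hx]

theorem mul_add_normSq_nonneg {r : ℝ} {z w : ℂ} (hr : 0 ≤ r) :
    0 ≤ r * (Complex.normSq z + Complex.normSq w) :=
  mul_nonneg hr (add_nonneg (Complex.normSq_nonneg z) (Complex.normSq_nonneg w))

theorem mul_add_normSq_eq_zero_iff {r : ℝ} {z w : ℂ} (hr : 0 < r) :
    r * (Complex.normSq z + Complex.normSq w) = 0 ↔ z = 0 ∧ w = 0 := by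
  rw [mul_eq_zero_iff_left hr.ne',
    add_eq_zero_iff_of_nonneg (Complex.normSq_nonneg z) (Complex.normSq_nonneg w),
    Complex.normSq_eq_zero, Complex.normSq_eq_zero]

theorem MaximalPair.boundary_eq (hv : P.MaximalPair v G K) (h : IsAdjointPair P.R G K) :
    (cA G = P.Ba' v ∧ cA K = P.Ba v) ∧ (cB G = -P.Bb' v ∧ cB K = P.Bb v) ∧
      ∀ i, P.transδ i v = 0 ∧ P.transγ i v = 0 := by
  obtain ⟨u, F, hu, ⟨ha, ha'⟩, ⟨hb, hb'⟩, hi⟩ := P.exists_represents_boundary_eq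
    (cA G - P.Ba' v) (-(cA K - P.Ba v)) (cB G + P.Bb' v) (cB K - P.Bb v)
    (fun i => -P.transγ i v) fun i => P.transδ i v
  have hinner := h ⟨F, u, hu⟩
  rw [R_apply _ hu, eq_comm, ← sub_eq_zero, lagrange_identity hu hv] at hinner
  simp only [ha, ha', hb, hb', (hi _).1, (hi _).2] at hinner
  have hsum : P.weightA * (Complex.normSq (cA G - P.Ba' v) + Complex.normSq (cA K - P.Ba v)) +
      P.weightB * (Complex.normSq (cB G + P.Bb' v) + Complex.normSq (cB K - P.Bb v)) +
      ∑ i, P.thetaRest i *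
        (Complex.normSq (P.transγ i v) + Complex.normSq (P.transδ i v)) = (0 : ℝ) := by
    apply Complex.ofReal_injective
    push_cast
    simp only [← Complex.mul_conj]
    rw [← hinner, sub_eq_add_neg _ (∑ i, _), ← Finset.sum_neg_distrib]
    congr 1
    · ring
    · exact Finset.sum_congr rfl fun i _ => by ring
  rw [add_eq_zero_iff_of_nonneg
      (add_nonneg (mul_add_normSq_nonneg P.weightA.2.le) (mul_add_normSq_nonneg P.weightB.2.le))
      (Finset.sum_nonneg fun i _ => mul_add_normSq_nonneg (thetaRest_pos i).le),
    add_eq_zero_iff_of_nonneg (mul_add_normSq_nonneg P.weightA.2.le)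
      (mul_add_normSq_nonneg P.weightB.2.le),
    Finset.sum_eq_zero_iff_of_nonneg fun i _ => mul_add_normSq_nonneg (thetaRest_pos i).le,
    mul_add_normSq_eq_zero_iff P.weightA.2, mul_add_normSq_eq_zero_iff P.weightB.2] at hsum
  obtain ⟨⟨⟨hA', hA⟩, hB', hB⟩, hi⟩ := hsum
  exact ⟨⟨sub_eq_zero.1 hA', sub_eq_zero.1 hA⟩,
    ⟨eq_neg_of_add_eq_zero_left hB', sub_eq_zero.1 hB⟩,
    fun i => ((mul_add_normSq_eq_zero_iff (thetaRest_pos i)).1 (hi i (Finset.mem_univ i))).symm⟩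

theorem mem_graph_R_of_isAdjointPair (h : IsAdjointPair P.R G K) : (G, K) ∈ P.R.graph := by
  obtain ⟨v, hv⟩ := exists_maximalPair_of_isAdjointPair h
  obtain ⟨⟨ha', ha⟩, ⟨hb', hb⟩, hi⟩ := hv.boundary_eq h
  have hG := hv.piecewiseH2.represents (fun i => (hi i).1) (fun i => (hi i).2) hv.fn_eq ha' hb'
  refine (LinearPMap.mem_graph_iff _).2 ⟨⟨G, v, hG⟩, rfl, (R_apply _ hG).trans ?_⟩
  refine H_ext (fun k => Lp.ext ((hG.maximalPair.fn_eq_ell k).trans (hv.fn_eq_ell k).symm)) ?_ ?_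
  · rw [hG.cA_image, ha]
  · rw [hG.cB_image, hb]

theorem isSelfAdjoint_R : IsSelfAdjoint P.R :=
  isSelfAdjoint_of_forall_isAdjointPair isFormalAdjoint_R fun _ _ => mem_graph_R_of_isAdjointPair

end SelfAdjoint

section Eigenvalues

variable {lam : ℂ}

theorem Represents.eq_zero (hu : P.Represents u F) (h : ∀ k, ∀ x ∈ P.piece k, u x = 0) :
    F = 0 := by
  have h0 := represents_zero P
  have hc : P.IsComb 0 (fun _ => 0) (fun _ => 0) u := fun k x hx => by simp [h k x hx]
  obtain ⟨⟨-, hA, -, hB⟩, -⟩ := hc.functionals h0 h0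
  refine H_ext (fun k => Lp.ext ?_) ?_ ?_
  · filter_upwards [hu.fn_eq k, h0.fn_eq k, ae_restrict_mem measurableSet_Ioo] with x hux hzero hx
    rw [hux, hzero, h k x hx]
  · rw [hu.cA_eq, h0.cA_eq, hA, zero_mul, add_zero]
  · rw [hu.cB_eq, h0.cB_eq, hB, zero_mul, add_zero]

theorem Represents.hasDerivAt_deriv {k : Fin (n + 1)} {h : ℝ → ℂ} (hu : P.Represents u F)
    (hcont : ContinuousOn h (P.piece k)) (hell : P.ell k u =ᵐ[P.pieceMeasure k] h) {x : ℝ}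
    (hx : x ∈ P.piece k) : HasDerivAt (deriv u) (P.secondDeriv k u h x) x :=
  ((hu.piecewiseH2 k).isPrimitiveOn_deriv.congr (eqOn_refl _ _)
    (hell.mono fun _ => ell_eq_iff.1)).hasDerivAt
    (continuousOn_secondDeriv (hu.diff k).continuousOn hcont) hx

theorem Represents.isSolution (hu : P.Represents u F) (h : hu.image = lam • F) :
    P.IsSolution lam u := by
  have hell (k : Fin (n + 1)) : P.ell k u =ᵐ[P.pieceMeasure k] fun x => lam * u x := by
    have hfn : fn hu.image k = lam • fn F k := by rw [h]; rfl
    filter_upwards [hu.maximalPair.fn_eq_ell k, Lp.coeFn_smul lam (fn F k), hu.fn_eq k]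
      with x hx hsmul hux
    rw [← hx, hfn, hsmul, Pi.smul_apply, hux, smul_eq_mul]
  have hderiv (k : Fin (n + 1)) (x : ℝ) (hx : x ∈ P.piece k) :=
    hu.hasDerivAt_deriv (continuousOn_const.mul (hu.diff k).continuousOn) (hell k) hx
  have hA : P.Ba u = lam * cA F := congrArg cA h
  have hB : P.Bb u = lam * cB F := congrArg cB h
  exact
    { diff := hu.diff
      diff' := fun k x hx => (hderiv k x hx).differentiableAt.differentiableWithinAt
      lim := hu.lim
      lim' := hu.lim'
      eqn := fun k x hx => ell_eq_iff.2 (hderiv k x hx).deriv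
      left := by rw [hA, hu.cA_eq, sub_self]
      right := by rw [hB, hu.cB_eq]; ring
      trans₁ := hu.trans₁
      trans₂ := hu.trans₂ }

theorem IsSolution.piecewiseH2 (hu : P.IsSolution lam u) : P.PiecewiseH2 u := fun k => by
  have hu₂ : MemLp u 2 (P.pieceMeasure k) :=
    (memLp_top_of_hasEndLimits (hu.diff k).continuousOn (hu.lim k)).mono_exponent le_top
  have hu₂' : MemLp (deriv u) 2 (P.pieceMeasure k) :=
    (memLp_top_of_hasEndLimits (hu.diff' k).continuousOn (hu.lim' k)).mono_exponent le_top
  have hu₂'' : MemLp (deriv (deriv u)) 2 (P.pieceMeasure k) := by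
    refine (memLp_secondDeriv hu₂ (hu₂.const_mul lam)).ae_eq ?_
    filter_upwards [ae_restrict_mem measurableSet_Ioo] with x hx
    exact (ell_eq_iff.1 (hu.eqn k x hx)).symm
  exact ⟨.of_hasDerivAt (hu₂'.integrable one_le_two) fun x hx =>
      ((hu.diff k).differentiableAt (isOpen_Ioo.mem_nhds hx)).hasDerivAt,
    .of_hasDerivAt (hu₂''.integrable one_le_two) fun x hx =>
      ((hu.diff' k).differentiableAt (isOpen_Ioo.mem_nhds hx)).hasDerivAt, hu₂''⟩

theorem IsSolution.exists_represents (hu : P.IsSolution lam u) :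
    ∃ F, ∃ h : P.Represents u F, h.image = lam • F := by
  obtain ⟨F, hF⟩ := hu.piecewiseH2.exists_represents hu.trans₁ hu.trans₂
  refine ⟨F, hF, H_ext (fun k => Lp.ext ?_) ?_ ?_⟩
  · change _ =ᵐ[P.pieceMeasure k] (lam • fn F k : Lp ℂ 2 (P.pieceMeasure k))
    filter_upwards [hF.maximalPair.fn_eq_ell k, Lp.coeFn_smul lam (fn F k), hF.fn_eq k,
      ae_restrict_mem measurableSet_Ioo] with x hell hsmul hux hx
    rw [hell, hsmul, Pi.smul_apply, hux, smul_eq_mul, hu.eqn k x hx]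
  · change P.Ba u = lam * cA F
    rw [hF.cA_eq]
    exact sub_eq_zero.1 hu.left
  · change P.Bb u = lam * cB F
    rw [hF.cB_eq]
    linear_combination hu.right

theorem hasEigenvalue_R_iff :
    (∃ F : P.R.domain, (F : P.H) ≠ 0 ∧ P.R F = lam • (F : P.H)) ↔ P.IsEigenvalue lam := by
  constructor
  · rintro ⟨F, hF, h⟩
    obtain ⟨u, hu⟩ := F.2
    rw [R_apply F hu] at h
    refine ⟨u, hu.isSolution h, ?_⟩
    by_contra! h0
    exact hF (hu.eq_zero h0)
  · rintro ⟨u, hu, k, x, hx, hne⟩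
    obtain ⟨F, hF, h⟩ := hu.exists_represents
    refine ⟨⟨F, ⟨u, hF⟩⟩, fun h0 : F = 0 => hne ?_, by rw [R_apply _ hF, h]⟩
    subst h0
    exact hF.eqOn (represents_zero P) k hx

end Eigenvalues

end

end TransmissionProblem

theorem mainTheorem2 {n : ℕ} (P : TransmissionProblem n) :
    IsSelfAdjoint P.R ∧
      ∀ lam : ℂ, (∃ F : P.R.domain, (F : P.H) ≠ 0 ∧ P.R F = lam • (F : P.H)) ↔
        P.IsEigenvalue lam :=
  ⟨TransmissionProblem.isSelfAdjoint_R, fun _ => TransmissionProblem.hasEigenvalue_R_iff⟩
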